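/- Let $n\ge 0$ and $m=\lfloor n/2\rfloor$. Let $\{e_i\}$ be the standard basis of $\mathbb{R}^n$, and let $e_{ij}\in\mathfrak{so}(n)$ be the endomorphism $u\mapsto\langle e_i,u\rangle e_j-\langle e_j,u\rangle e_i$. Weights of a complex representation of $\mathfrak{so}(n)$ are the $\nu=(\nu^1,\dots,\nu^m)\in\mathbb{R}^m$ such that $-\sqrt{-1}\,e_{2k-1,2k}$ $(1\le k\le m)$ have a common non-zero eigenvector with eigenvalues $\nu^k$; the highest weight is the greatest one in the lexicographical order. Put $\delta=(m-1,m-2,\dots,0)$ if $n=2m$ and $\delta=(m-\frac12,m-\frac32,\dots,\frac12)$ if $n=2m+1$. Let $(\pi_\rho,V_\rho)$ be a finite-dimensional irreducible unitary representation of $\mathfrak{so}(n)$ (for instance, the differential of one of $SO(n)$ or $Spin(n)$) with highest weight $\rho$, and let $V_\rho\otimes\mathbb{C}^n=\bigoplus_\lambda V_\lambda$ be the orthogonal decomposition of its tensor product with the natural representation, where $\lambda$ runs over the highest weights of the irreducible components and $V_\lambda$ is the component of highest weight $\lambda$ (each $\lambda$ occurs with multiplicity one). For $\xi\in\mathbb{C}^n$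 the Clifford homomorphism $p^\rho_\lambda(\xi):V_\rho\to V_\lambda$ sends $\phi$ to the orthogonal projection of $\phi\otimes\xi$ to $V_\lambda$, and $p^\rho_\lambda(\xi)^*$ is its adjoint. Put $$w(\rho;\lambda)=\tfrac12\big(\langle\delta+\lambda,\delta+\lambda\rangle-\langle\delta+\rho,\delta+\rho\rangle-n+1\big),\qquad \hat w(\rho;\lambda)=w(\rho;\lambda)+\tfrac{n-1}{2}.$$ In the enveloping algebra $U(\mathfrak{so}(n,\mathbb{C}))$ let $\hat e_{ij}=e_{ij}+\frac{n-1}{2}\delta_{ij}$, let $\hat e^{\,q}_{ij}$ be the $(i,j)$ entry of the $q$-th power of the matrix $(\hat e_{kl})_{k,l}$, let $\hat c_q=\sum_i\hat e^{\,q}_{ii}$, and, for $n=2m$, $$\mathrm{pf}=\frac{1}{(\sqrt{-1})^m2^mm!}\sum_{\sigma\in\mathfrak{S}_{2m}}\mathrm{sign}(\sigma)\,e_{\sigma(1)\sigma(2)}\cdots e_{\sigma(2m-1)\sigma(2m)}.$$ Then the elements $\hat c_q$ $(q\ge 0)$ act on $V_\rho$ as constants $\pi_\rho(\hat c_q)$;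 for $n=2m$ the element $\mathrm{pf}$ acts on $V_\rho$ and on each $V_\lambda$ as constants $\pi_\rho(\mathrm{pf})$ and $\pi_\lambda(\mathrm{pf})$; and, for all $\xi,\eta\in\mathbb{R}^n$, as endomorphisms of $V_\rho$, $$\sum_\lambda\big(p^\rho_\lambda(\xi)^*p^\rho_\lambda(\eta)+p^\rho_\lambda(\eta)^*p^\rho_\lambda(\xi)\big)=2\langle\xi,\eta\rangle,$$ $$\sum_\lambda\Big\{\sum_{p=0}^{2q-1}(-\hat w(\rho;\lambda))^p\,\pi_\rho(\hat c_{2q-1-p})\Big\}\big(p^\rho_\lambda(\xi)^*p^\rho_\lambda(\eta)+p^\rho_\lambda(\eta)^*p^\rho_\lambda(\xi)\big)=0\qquad(q=1,2,\dots),$$ and, if $n=2m$, $$\sum_\lambda\pi_\lambda(\mathrm{pf})\big(p^\rho_\lambda(\xi)^*p^\rho_\lambda(\eta)+p^\rho_\lambda(\eta)^*p^\rho_\lambda(\xi)\big)=2\pi_\rho(\mathrm{pf})\langle\xi,\eta\rangle,$$ $$\sum_\lambda\pi_\lambda(\mathrm{pf})\,(w(\rho;\lambda)-1)\big(p^\rho_\lambda(\xi)^*p^\rho_\lambda(\eta)+p^\rho_\lambda(\eta)^*p^\rho_\lambda(\xi)\big)=0.$$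 -/

import Mathlib

open scoped TensorProduct

attribute [local instance 100] LieRing.ofAssociativeRing

noncomputable section

namespace CliffordHom

/-- The complex Lie algebra `𝔰𝔬(n, ℂ)` of skew-symmetric `n × n` matrices, the complexification of
`𝔰𝔬(n)`. Complex representations of `𝔰𝔬(n)` are the same thing as representations of it. -/
abbrev SO (n : ℕ) : LieSubalgebra ℂ (Matrix (Fin n) (Fin n) ℂ) :=
  LieAlgebra.Orthogonal.so (Fin n) ℂ

/-- The universal enveloping algebra `U(𝔰𝔬(n, ℂ))`. -/
abbrev U (n : ℕ) : Type :=
  UniversalEnvelopingAlgebra ℂ (SO n)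

/-- The basis element `e_{ij} = e_i ∧ e_j` of `𝔰𝔬(n)`, that is, the endomorphism
`u ↦ ⟨e_i, u⟩ e_j - ⟨e_j, u⟩ e_i`. -/
def e (n : ℕ) (i j : Fin n) : SO n :=
  ⟨Matrix.single j i 1 - Matrix.single i j 1, by
    rw [LieAlgebra.Orthogonal.mem_so]
    simp⟩

/-- The space `ℂⁿ` with its standard Hermitian inner product. -/
abbrev Cn (n : ℕ) : Type :=
  EuclideanSpace ℂ (Fin n)

/-- The natural representation of `𝔰𝔬(n, ℂ)` on `ℂⁿ`: matrices act on column vectors. -/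
instance natLieRingModule (n : ℕ) : LieRingModule (SO n) (Cn n) where
  bracket X u := WithLp.toLp 2 (X.1.mulVec u.ofLp)
  add_lie X Y u := by
    ext i
    simp [Matrix.add_mulVec]
  lie_add X u v := by
    ext i
    simp [Matrix.mulVec_add]
  leibniz_lie X Y u := by
    ext i
    simp [LieRing.of_associative_ring_bracket, Matrix.sub_mulVec, Matrix.mulVec_mulVec]

instance natLieModule (n : ℕ) : LieModule ℂ (SO n) (Cn n) where
  smul_lie c X u := by
    ext i
    change ((c • X.1).mulVec u.ofLp) i = c * (X.1.mulVec u.ofLp) i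
    simp [Matrix.smul_mulVec]
  lie_smul c X u := by
    ext i
    change (X.1.mulVec (c • u.ofLp)) i = c * (X.1.mulVec u.ofLp) i
    simp [Matrix.mulVec_smul]

/-- The inclusion of `ℝⁿ` into `ℂⁿ`. -/
def toCn {n : ℕ} (ξ : EuclideanSpace ℝ (Fin n)) : Cn n :=
  WithLp.toLp 2 fun i => (ξ i : ℂ)

/-- The representation is (infinitesimally) unitary: the real form `𝔰𝔬(n)` of real skew-symmetric
matrices acts by skew-Hermitian operators. -/
def IsUnitaryRep (n : ℕ) (V : Type*) [NormedAddCommGroup V] [InnerProductSpace ℂ V]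
    [LieRingModule (SO n) V] : Prop :=
  ∀ X : SO n, (∀ i j, (X.1 i j).im = 0) →
    ∀ v w : V, inner ℂ ⁅X, v⁆ w = -inner ℂ v ⁅X, w⁆

section Weights

variable (n : ℕ) (M : Type*) [AddCommGroup M] [Module ℂ M] [LieRingModule (SO n) M]

/-- The index `2k - 1` of the basis vector of the `k`-th coordinate plane (from zero: `2k`). -/
def idxOdd {n : ℕ} (k : Fin (n / 2)) : Fin n := ⟨2 * k, by omega⟩

/-- The index `2k` of the basis vector of the `k`-th coordinate plane (from zero: `2k + 1`). -/
def idxEven {n : ℕ} (k : Fin (n / 2)) : Fin n := ⟨2 * k + 1, by omega⟩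

/-- `ν = (ν¹, …, νᵐ)`, `m = ⌊n/2⌋`, is a weight of `M`: there is a common eigenvector `v ≠ 0` of the
operators `-√-1 e_{2k-1,2k}`, with eigenvalues `νᵏ`. -/
def IsWeight (ν : Fin (n / 2) → ℝ) : Prop :=
  ∃ v : M, v ≠ 0 ∧ ∀ k, -Complex.I • ⁅e n (idxOdd k) (idxEven k), v⁆ = (ν k : ℂ) • v

/-- `ρ` is the highest weight of `M`: the greatest weight in the lexicographical order. -/
def IsHighestWeight (ρ : Fin (n / 2) → ℝ) : Prop :=
  IsWeight n M ρ ∧ ∀ ν, IsWeight n M ν → toLex ν ≤ toLex ρ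

/-- `lam` is the highest weight of an irreducible submodule of `M`. -/
def IsConstituent (lam : Fin (n / 2) → ℝ) : Prop :=
  ∃ W : LieSubmodule ℂ (SO n) M, LieModule.IsIrreducible ℂ (SO n) W ∧ IsHighestWeight n W lam

theorem finite_isConstituent [LieModule ℂ (SO n) M] [FiniteDimensional ℂ M] :
    {lam | IsConstituent n M lam}.Finite := by
  let T : Fin (n / 2) → Module.End ℂ M := fun k =>
    -Complex.I • LieModule.toEnd ℂ (SO n) M (e n (idxOdd k) (idxEven k))
  have hfin : ∀ k, {x : ℝ | (T k).HasEigenvalue (x : ℂ)}.Finite := fun k =>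
    Set.Finite.preimage (Complex.ofReal_injective.injOn) (T k).finite_hasEigenvalue
  refine (Set.Finite.pi' hfin).subset ?_
  rintro lam ⟨W, -, ⟨⟨v, hv, hw⟩, -⟩⟩ k
  refine Module.End.hasEigenvalue_of_hasEigenvector (x := (v : M)) ⟨?_, ?_⟩
  · rw [Module.End.mem_eigenspace_iff]
    exact congrArg Subtype.val (hw k)
  · simpa using hv

/-- The finite set of highest weights of the irreducible submodules of `M`. -/
def constituents [LieModule ℂ (SO n) M] [FiniteDimensional ℂ M] : Finset (Fin (n / 2) → ℝ) :=
  (finite_isConstituent n M).toFinset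

/-- The component of `M` of highest weight `lam`: the span of all irreducible submodules with that
highest weight. When `lam` has multiplicity one, as it always has in `V_ρ ⊗ ℂⁿ`, this is the
irreducible submodule `V_lam`. -/
def component (lam : Fin (n / 2) → ℝ) : LieSubmodule ℂ (SO n) M :=
  sSup {W | LieModule.IsIrreducible ℂ (SO n) W ∧ IsHighestWeight n W lam}

end Weights

section Casimir

variable (n : ℕ)

/-- The matrix with entries `ê_{ij} = e_{ij} + (n-1)/2 δ_{ij}` in the enveloping algebra. The
entries of its `q`-th power are the elements `ê_{ij}^q`. -/
def eHat : Matrix (Fin n) (Fin n) (U n) :=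
  Matrix.of fun i j =>
    UniversalEnvelopingAlgebra.ι ℂ (e n i j) +
      algebraMap ℂ (U n) (if i = j then ((n : ℂ) - 1) / 2 else 0)

/-- The translated Casimir element `ĉ_q = ∑ᵢ ê_{ii}^q`. -/
def cHat (q : ℕ) : U n :=
  ∑ i, (eHat n ^ q) i i

/-- The Pfaffian element, for `n = 2m`:
`(√-1^m 2^m m!)⁻¹ ∑_σ sign(σ) e_{σ(1)σ(2)} e_{σ(3)σ(4)} ⋯ e_{σ(2m-1)σ(2m)}`. -/
def pf : U n :=
  (Complex.I ^ (n / 2) * 2 ^ (n / 2) * ((n / 2).factorial : ℂ))⁻¹ •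
    ∑ σ : Equiv.Perm (Fin n), ((Equiv.Perm.sign σ : ℤ) : ℂ) •
      (List.ofFn fun k : Fin (n / 2) =>
        UniversalEnvelopingAlgebra.ι ℂ (e n (σ (idxOdd k)) (σ (idxEven k)))).prod

/-- The action of the enveloping algebra on a representation. -/
def act (M : Type*) [AddCommGroup M] [Module ℂ M] [LieRingModule (SO n) M]
    [LieModule ℂ (SO n) M] : U n →ₐ[ℂ] Module.End ℂ M :=
  UniversalEnvelopingAlgebra.lift ℂ (LieModule.toEnd ℂ (SO n) M)

/-- The element `z` of the enveloping algebra acts on `M` as the constant `c`. -/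
def ActsAs (M : Type*) [AddCommGroup M] [Module ℂ M] [LieRingModule (SO n) M]
    [LieModule ℂ (SO n) M] (z : U n) (c : ℂ) : Prop :=
  ∀ v : M, act n M z v = c • v

end Casimir

section ConformalWeight

variable {n : ℕ}

/-- Half the sum of the positive roots: `(m-1, …, 1, 0)` for `n = 2m` and
`(m-1/2, …, 3/2, 1/2)` for `n = 2m+1`. -/
def delta (n : ℕ) (k : Fin (n / 2)) : ℝ :=
  (n : ℝ) / 2 - 1 - (k : ℝ)

/-- The conformal weight
`w(ρ; lam) = (⟨δ + lam, δ + lam⟩ - ⟨δ + ρ, δ + ρ⟩ - n + 1) / 2`. -/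
def confWeight (ρ lam : Fin (n / 2) → ℝ) : ℝ :=
  1 / 2 * (∑ k, (delta n k + lam k) ^ 2 - ∑ k, (delta n k + ρ k) ^ 2 - (n : ℝ) + 1)

/-- The translated conformal weight `ŵ(ρ; lam) = w(ρ; lam) + (n-1)/2`. -/
def confWeightHat (ρ lam : Fin (n / 2) → ℝ) : ℝ :=
  confWeight ρ lam + ((n : ℝ) - 1) / 2

end ConformalWeight

section Clifford

variable {n : ℕ} (V : Type*) [NormedAddCommGroup V] [InnerProductSpace ℂ V]
  [FiniteDimensional ℂ V] [LieRingModule (SO n) V] [LieModule ℂ (SO n) V]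

/-- The component `V_lam` of `V ⊗ ℂⁿ`, with the inner product of `V ⊗ ℂⁿ`. -/
abbrev Comp (lam : Fin (n / 2) → ℝ) : Submodule ℂ (V ⊗[ℂ] Cn n) :=
  (component n (V ⊗[ℂ] Cn n) lam).toSubmodule

/-- The Clifford homomorphism `p_lam(ξ) : V → V_lam`: the orthogonal projection of `φ ⊗ ξ` to
`V_lam`. -/
def p (lam : Fin (n / 2) → ℝ) (ξ : Cn n) : V →ₗ[ℂ] Comp V lam :=
  (Comp V lam).orthogonalProjectionOnto.toLinearMap ∘ₗ (TensorProduct.mk ℂ V (Cn n)).flip ξ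

/-- The adjoint `p_lam(ξ)^* : V_lam → V`. -/
def pStar (lam : Fin (n / 2) → ℝ) (ξ : Cn n) : Comp V lam →ₗ[ℂ] V :=
  LinearMap.adjoint (𝕜 := ℂ) (E := V) (F := Comp V lam) (p V lam ξ)

/-- The symmetrized product `p_lam(ξ)^* p_lam(η) + p_lam(η)^* p_lam(ξ)` on `V`, for `ξ, η` in
`ℝⁿ`. -/
def symmProd (lam : Fin (n / 2) → ℝ) (ξ η : EuclideanSpace ℝ (Fin n)) : V →ₗ[ℂ] V :=
  pStar V lam (toCn ξ) ∘ₗ p V lam (toCn η) + pStar V lam (toCn η) ∘ₗ p V lam (toCn ξ)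

end Clifford

end CliffordHom

end

open CliffordHom

/-! Operators on `V ⊗ ℂⁿ` are `n × n` matrices `A` with entries in `End V` (the algebra map `op`).
If `op A` acts on every `V_λ` as a scalar `f(λ)`, then pairing with `ψ ⊗ ξ` and `φ ⊗ η` and
inserting the orthogonal decomposition shows that `∑ f(λ) p_λ(ξ)^* p_λ(η)` is `∑ ξ_k η_l A_{kl}`.
Symmetrizing in `ξ, η` replaces `A` by `A + Aᵀ`, so each identity amounts to a matrix `A` for which
`A + Aᵀ` is a scalar (`sum_smul_symmProd_of_scalar`). Here `ᵀ` only permutes entries and does not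
reverse products.

Let `E = (e_{ij})` with entries acting on `V`. Comparing the Casimir operators of `V`, `ℂⁿ` and `V ⊗
ℂⁿ` shows that `E` acts on `V_λ` as `w(ρ; λ)` (`op_gen_of_mem_component`). The four choices of `A`
are: (1) the identity; (2) `∑ ĉ_{2q-1-r} (-Ê)^r`, with `Ê = E + (n-1)/2`: moving entries past each
other shows that it equals `(Ê^{2q})ᵀ - Ê^{2q}`, hence it is skew; (3) the action of `pf` on `V ⊗
ℂⁿ`: it is `π_ρ(pf) + P` with `P` skew, since products of the natural action in disjoint coordinate
planes vanish; (4) `(π_ρ(pf) + P)(E - 1)`: here `PE` is equivariant with all diagonal entries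
`π_ρ(pf)`, which forces `PE + (PE)ᵀ = 2 π_ρ(pf)`, and everything else cancels.

The constants come from Schur's lemma on `V` and from highest weight vectors on `V_λ`. Multiplicity
one is never needed: a central element takes equal values on any two irreducible submodules with the
same highest weight (`eigenvalue_eq_of_highestSpace`). -/

noncomputable section

namespace CliffordHom

/-! ### Matrices over an algebra containing `𝔰𝔬(n)` -/

section MatrixRing

variable {n : ℕ} {R : Type*} [Ring R]

/-- The relations satisfied by the images of the `e_{ij}` in an associative algebra. -/
structure SoRel (x : Fin n → Fin n → R) : Prop where
  skew : ∀ i j, x j i = -x i j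
  bracket : ∀ i j k l, x i j * x k l - x k l * x i j =
    (if i = k then x j l else 0) - (if j = k then x i l else 0) +
      (if i = l then x k j else 0) - (if j = l then x k i else 0)

/-- The skew matrix of `e_{ij}` acting on column vectors. -/
def skewUnit (R : Type*) [Ring R] {n : ℕ} (i j : Fin n) : Matrix (Fin n) (Fin n) R :=
  Matrix.single j i 1 - Matrix.single i j 1

/-- The action of `e_{ij}` on a tensor product with the natural representation. -/
def tensorGen (x : Fin n → Fin n → R) (i j : Fin n) : Matrix (Fin n) (Fin n) R :=
  Matrix.scalar (Fin n) (x i j) + skewUnit R i j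

theorem skewUnit_apply (i j k l : Fin n) :
    skewUnit R i j k l =
      (if j = k then if i = l then 1 else 0 else 0) -
        (if i = k then if j = l then 1 else 0 else 0) := by
  simp [skewUnit, Matrix.single_apply, ite_and]

theorem skewUnit_swap (i j : Fin n) : skewUnit R j i = -skewUnit R i j := by
  simp [skewUnit]

/-- Entry by entry, commuting with the action on the tensor product says that `T k l` transforms
like `e_{kl}`. Commutation passes to products, so powers inherit the entrywise relation at once. -/
theorem bracket_apply_of_commute {x : Fin n → Fin n → R} {T : Matrix (Fin n) (Fin n) R}
    {i j : Fin n} (h : Commute (tensorGen x i j) T) (k l : Fin n) :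
    x i j * T k l - T k l * x i j =
      (if i = k then T j l else 0) - (if j = k then T i l else 0) +
        (if i = l then T k j else 0) - (if j = l then T k i else 0) := by
  have := congrFun (congrFun h.eq k) l
  simp only [tensorGen, add_mul, mul_add, Matrix.add_apply] at this
  have h1 : (Matrix.scalar (Fin n) (x i j) * T) k l = x i j * T k l := by
    simp [Matrix.scalar_apply, Matrix.diagonal_mul]
  have h2 : (T * Matrix.scalar (Fin n) (x i j)) k l = T k l * x i j := by
    simp [Matrix.scalar_apply, Matrix.mul_diagonal]
  have h3 : (skewUnit R i j * T) k l = (if j = k then T i l else 0) -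
      (if i = k then T j l else 0) := by
    simp [Matrix.mul_apply, skewUnit_apply, sub_mul, Finset.sum_sub_distrib, ite_mul]
  have h4 : (T * skewUnit R i j) k l = (if i = l then T k j else 0) -
      (if j = l then T k i else 0) := by
    simp [Matrix.mul_apply, skewUnit_apply, mul_sub, Finset.sum_sub_distrib, mul_ite]
  rw [h1, h2, h3, h4] at this
  rw [sub_eq_iff_eq_add, eq_sub_of_add_eq this]
  abel

theorem commute_of_bracket_apply {x : Fin n → Fin n → R} {T : Matrix (Fin n) (Fin n) R}
    {i j : Fin n} (h : ∀ k l, x i j * T k l - T k l * x i j =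
      (if i = k then T j l else 0) - (if j = k then T i l else 0) +
        (if i = l then T k j else 0) - (if j = l then T k i else 0)) :
    Commute (tensorGen x i j) T := by
  refine Matrix.ext fun k l => ?_
  simp only [tensorGen, add_mul, mul_add, Matrix.add_apply]
  have h1 : (Matrix.scalar (Fin n) (x i j) * T) k l = x i j * T k l := by
    simp [Matrix.scalar_apply, Matrix.diagonal_mul]
  have h2 : (T * Matrix.scalar (Fin n) (x i j)) k l = T k l * x i j := by
    simp [Matrix.scalar_apply, Matrix.mul_diagonal]
  have h3 : (skewUnit R i j * T) k l = (if j = k then T i l else 0) -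
      (if i = k then T j l else 0) := by
    simp [Matrix.mul_apply, skewUnit_apply, sub_mul, Finset.sum_sub_distrib, ite_mul]
  have h4 : (T * skewUnit R i j) k l = (if i = l then T k j else 0) -
      (if j = l then T k i else 0) := by
    simp [Matrix.mul_apply, skewUnit_apply, mul_sub, Finset.sum_sub_distrib, mul_ite]
  rw [h1, h2, h3, h4, sub_eq_iff_eq_add.1 (h k l)]
  abel

theorem SoRel.commute_tensorGen {x : Fin n → Fin n → R} (hx : SoRel x) (i j : Fin n) :
    Commute (tensorGen x i j) (Matrix.of x) :=
  commute_of_bracket_apply fun k l => by simpa using hx.bracket i j k l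

/-- On the diagonal the four bracket terms cancel in pairs after summation; this makes the Casimir
elements central. -/
theorem commute_trace {x : Fin n → Fin n → R} {T : Matrix (Fin n) (Fin n) R} {i j : Fin n}
    (h : Commute (tensorGen x i j) T) : Commute (x i j) T.trace := by
  refine sub_eq_zero.1 ?_
  simp only [Matrix.trace, Matrix.diag_apply, Finset.mul_sum, Finset.sum_mul,
    ← Finset.sum_sub_distrib, bracket_apply_of_commute h]
  simp [Finset.sum_add_distrib, Finset.sum_sub_distrib]

/-- Bracketing `x k l` with the central entry `T k k` gives zero, and the equivariance relation
evaluates that bracket as `T l k + T k l`. -/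
theorem add_transpose_apply_of_diag {x : Fin n → Fin n → R} {T : Matrix (Fin n) (Fin n) R}
    {a : R} (h : ∀ i j, Commute (tensorGen x i j) T) (hd : ∀ k, T k k = a)
    (ha : ∀ i j, Commute (x i j) a) : T + T.transpose = Matrix.scalar (Fin n) (a + a) := by
  ext k l
  rcases eq_or_ne k l with rfl | hkl
  · simp [hd]
  · have := bracket_apply_of_commute (h k l) k k
    rw [hd, (ha k l).eq, sub_self] at this
    simpa [hkl, hkl.symm, add_comm, eq_comm] using this

/-- Transposing a product with the translated matrix `ê`. -/
theorem transpose_mul_eHat [Algebra ℂ R] {x : Fin n → Fin n → R} (hx : SoRel x)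
    {T A : Matrix (Fin n) (Fin n) R}
    (hA : A = Matrix.of x + algebraMap ℂ _ (((n : ℂ) - 1) / 2))
    (h : ∀ i j, Commute (tensorGen x i j) T) :
    (T * A).transpose = -(A * T.transpose) + Matrix.scalar (Fin n) T.trace - T := by
  -- Reversing the order of the factors in each entry costs commutators: a trace, one `T` and `n -
  -- 1` copies of `Tᵀ`. The shift `(n-1)/2` in `A` is chosen to absorb those copies, half on each
  -- side of the identity.
  have key : (T * Matrix.of x).transpose = -(Matrix.of x * T.transpose) +
      Matrix.scalar (Fin n) T.trace - T - ((n : ℂ) - 1) • T.transpose := by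
    ext i k
    have h1 : (Matrix.of x * T.transpose) i k = ∑ j, (T k j * x i j +
        ((if i = k then T j j else 0) - (if j = k then T i j else 0) +
        (if i = j then T k j else 0) - (if j = j then T k i else 0))) := by
      simp only [Matrix.mul_apply, Matrix.transpose_apply, Matrix.of_apply]
      refine Finset.sum_congr rfl fun j _ => ?_
      exact (sub_eq_iff_eq_add.1 (bracket_apply_of_commute (h i j) k j)).trans
        (by simp only [if_true]; exact add_comm _ _)
    have h2 : ∑ j, T k j * x i j = -(T * Matrix.of x) k i := by
      simp [Matrix.mul_apply, ← Finset.sum_neg_distrib, hx.skew i]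
    rw [Finset.sum_add_distrib, h2] at h1
    simp only [Finset.sum_sub_distrib, Finset.sum_add_distrib, Finset.sum_ite_eq,
      Finset.sum_ite_eq', Finset.mem_univ, if_true, Finset.sum_const, Finset.card_univ,
      Fintype.card_fin] at h1
    have h3 : (∑ j, if i = k then T j j else 0) = Matrix.scalar (Fin n) T.trace i k := by
      rw [Matrix.scalar_apply, Matrix.diagonal_apply]
      split_ifs
      · rfl
      · simp
    rw [h3] at h1
    simp only [Matrix.transpose_apply, Matrix.sub_apply, Matrix.add_apply, Matrix.neg_apply,
      Matrix.smul_apply, h1, sub_smul, one_smul, Nat.cast_smul_eq_nsmul]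
    abel
  subst hA
  rw [mul_add, Matrix.transpose_add, key, add_mul, ← Algebra.commutes, ← Algebra.smul_def,
    ← Algebra.smul_def, Matrix.transpose_smul, sub_eq_add_neg _ ((_ : ℂ) • T.transpose)]
  have : ((n : ℂ) - 1) • T.transpose = (((n : ℂ) - 1) / 2) • T.transpose +
      (((n : ℂ) - 1) / 2) • T.transpose := by
    rw [← add_smul, add_halves]
  rw [this]
  abel

theorem SoRel.commute_eHat_pow [Algebra ℂ R] {x : Fin n → Fin n → R} (hx : SoRel x) (s : ℂ)
    (i j : Fin n) (q : ℕ) :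
    Commute (tensorGen x i j) ((Matrix.of x + algebraMap ℂ _ s) ^ q) :=
  ((hx.commute_tensorGen i j).add_right (Algebra.commutes _ _).symm).pow_right q

theorem transpose_eHat_pow [Algebra ℂ R] {x : Fin n → Fin n → R} (hx : SoRel x)
    {A : Matrix (Fin n) (Fin n) R}
    (hA : A = Matrix.of x + algebraMap ℂ _ (((n : ℂ) - 1) / 2)) {c : ℕ → ℂ}
    (hc : ∀ q, (A ^ q).trace = algebraMap ℂ R (c q)) (q : ℕ) :
    (A ^ (q + 1)).transpose = -(A * (A ^ q).transpose) + c q • 1 - A ^ q := by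
  rw [pow_succ, transpose_mul_eHat hx hA fun i j => ?_, hc, ← Algebra.algebraMap_eq_smul_one]
  · rfl
  · rw [hA]
    exact hx.commute_eHat_pow _ i j q

/-- The recursion is applied twice per induction step: the two terms `A ^ (2q+1)` then cancel, and
only trace terms are added. -/
theorem transpose_eHat_pow_even [Algebra ℂ R] {x : Fin n → Fin n → R} (hx : SoRel x)
    {A : Matrix (Fin n) (Fin n) R}
    (hA : A = Matrix.of x + algebraMap ℂ _ (((n : ℂ) - 1) / 2)) {c : ℕ → ℂ}
    (hc : ∀ q, (A ^ q).trace = algebraMap ℂ R (c q)) (q : ℕ) :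
    (A ^ (2 * q)).transpose =
      A ^ (2 * q) + ∑ r ∈ Finset.range (2 * q), c (2 * q - 1 - r) • (-A) ^ r := by
  induction q with
  | zero => simp
  | succ q ih =>
    have e1 : 2 * (q + 1) = 2 * q + 1 + 1 := by ring
    rw [e1, transpose_eHat_pow hx hA hc, transpose_eHat_pow hx hA hc, ih,
      Finset.sum_range_succ', Finset.sum_range_succ']
    have h1 : ∀ r, c (2 * q + 1 + 1 - 1 - (r + 1 + 1)) • (-A) ^ (r + 1 + 1) =
        A * A * (c (2 * q - 1 - r) • (-A) ^ r) := fun r => by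
      rw [show 2 * q + 1 + 1 - 1 - (r + 1 + 1) = 2 * q - 1 - r by omega, mul_smul_comm,
        pow_succ', pow_succ']
      noncomm_ring
    simp only [h1, ← Finset.mul_sum]
    have e2 : A ^ (2 * q + 1 + 1) = A * A * A ^ (2 * q) := by rw [pow_succ', pow_succ', mul_assoc]
    rw [e2, pow_succ']
    simp only [Nat.add_sub_cancel, Nat.sub_zero, zero_add, pow_one, pow_zero, mul_add, mul_sub,
      mul_neg, mul_smul_comm, mul_one, smul_neg, neg_add, neg_sub, mul_assoc]
    abel

/-- `Z` is the difference between the transpose of `A ^ (2q)` and `A ^ (2q)` itself, hence skew. -/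
theorem sum_trace_smul_eHat_pow [Algebra ℂ R] {x : Fin n → Fin n → R} (hx : SoRel x)
    {A : Matrix (Fin n) (Fin n) R}
    (hA : A = Matrix.of x + algebraMap ℂ _ (((n : ℂ) - 1) / 2)) {c : ℕ → ℂ}
    (hc : ∀ q, (A ^ q).trace = algebraMap ℂ R (c q)) (q : ℕ) :
    let Z := ∑ r ∈ Finset.range (2 * q), c (2 * q - 1 - r) • (-A) ^ r
    Z + Z.transpose = 0 := by
  intro Z
  have h : Z = (A ^ (2 * q)).transpose - A ^ (2 * q) :=
    eq_sub_of_add_eq' (transpose_eHat_pow_even hx hA hc q).symm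
  rw [h, Matrix.transpose_sub, Matrix.transpose_transpose]
  abel

/-- The square sum of the generators on a tensor product with the natural representation. -/
theorem SoRel.sum_tensorGen_mul_self {x : Fin n → Fin n → R} (hx : SoRel x) :
    ∑ i, ∑ j, tensorGen x i j * tensorGen x i j =
      Matrix.scalar (Fin n) (∑ i, ∑ j, x i j * x i j) - (4 : ℤ) • Matrix.of x
        - (2 : ℤ) • ((n : ℤ) - 1) • (1 : Matrix (Fin n) (Fin n) R) := by
  have h1 : ∀ i j, tensorGen x i j * tensorGen x i j = Matrix.scalar (Fin n) (x i j * x i j) +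
      (2 : ℤ) • (Matrix.scalar (Fin n) (x i j) * skewUnit R i j) +
        skewUnit R i j * skewUnit R i j := fun i j => by
    have : skewUnit R i j * Matrix.scalar (Fin n) (x i j) =
        Matrix.scalar (Fin n) (x i j) * skewUnit R i j := by
      ext k l
      simp only [Matrix.scalar_apply, Matrix.mul_diagonal, Matrix.diagonal_mul, skewUnit_apply]
      split_ifs <;> simp
    rw [tensorGen, add_mul, mul_add, mul_add, this, map_mul, two_smul]
    abel
  have h2 : ∑ i, ∑ j, Matrix.scalar (Fin n) (x i j) * skewUnit R i j =
      (-2 : ℤ) • Matrix.of x := by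
    ext k l
    simp only [Matrix.sum_apply]
    have : ∀ i j, (Matrix.scalar (Fin n) (x i j) * skewUnit R i j) k l =
      (if j = k then if i = l then x i j else 0 else 0) -
        (if i = k then if j = l then x i j else 0 else 0) := fun i j => by
      simp [Matrix.scalar_apply, Matrix.diagonal_mul, skewUnit_apply, mul_sub]
    simp only [this, Finset.sum_sub_distrib]
    simp [hx.skew k l, two_smul]
    abel
  -- The Casimir operator of the natural representation.
  have h3 : ∑ i : Fin n, ∑ j, skewUnit R i j * skewUnit R i j =
      -((2 : ℤ) • ((n : ℤ) - 1) • (1 : Matrix (Fin n) (Fin n) R)) := by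
    have h4 : ∀ i j : Fin n, skewUnit R i j * skewUnit R i j =
        (if i = j then Matrix.single j j 1 else 0) + (if i = j then Matrix.single j j 1 else 0) -
          Matrix.single j j 1 - Matrix.single i i 1 := fun i j => by
      rcases eq_or_ne i j with rfl | hij
      · simp [skewUnit]
      · simp [skewUnit, sub_mul, mul_sub, hij, hij.symm, Matrix.single_mul_single_of_ne]
        abel
    have h5 : ∑ j : Fin n, Matrix.single j j (1 : R) = 1 := by
      ext k l
      simp [Matrix.sum_apply, Matrix.single_apply, Matrix.one_apply, ite_and]
    simp only [h4, Finset.sum_sub_distrib, Finset.sum_add_distrib, Finset.sum_ite_eq,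
      Finset.mem_univ, if_true, h5, Finset.sum_const, Finset.card_univ, Fintype.card_fin,
      ← Finset.smul_sum, sub_smul, smul_sub, one_smul, natCast_zsmul, two_smul]
    abel
  simp only [h1, Finset.sum_add_distrib, h3, map_sum, ← Finset.smul_sum, h2]
  rw [smul_smul, show (2 * -2 : ℤ) = -4 by norm_num, neg_smul, ← sub_eq_add_neg, ← sub_eq_add_neg]

end MatrixRing

/-! ### Sums over coordinate planes and ordered products -/

/-- The hypothesis concerns only the last index for odd `n`, which lies in no coordinate plane. -/
theorem sum_fin_pairs {n : ℕ} {A : Type*} [AddCommMonoid A] (f : Fin n → A)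
    (h : ∀ i : Fin n, 2 * (n / 2) ≤ (i : ℕ) → f i = 0) :
    ∑ i, f i = ∑ k : Fin (n / 2), (f (idxOdd k) + f (idxEven k)) := by
  let g : Fin (n / 2) ⊕ Fin (n / 2) → Fin n := Sum.elim idxOdd idxEven
  have hg : Function.Injective g := by
    rintro (a | a) (b | b) hab <;>
      simp only [g, Sum.elim_inl, Sum.elim_inr, idxOdd, idxEven, Fin.mk.injEq] at hab
    · rw [Fin.ext (by omega : (a : ℕ) = b)]
    · omega
    · omega
    · rw [Fin.ext (by omega : (a : ℕ) = b)]
  rw [← Fintype.sum_of_injective g hg (fun s => f (g s)) f ?_ fun _ => rfl,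
    Fintype.sum_sum_type, Finset.sum_add_distrib]
  · rfl
  · intro i hi
    refine h i (not_lt.1 fun hlt => hi ?_)
    rcases Nat.even_or_odd' (i : ℕ) with ⟨c, hc | hc⟩
    · exact ⟨Sum.inl ⟨c, by omega⟩, Fin.ext hc.symm⟩
    · exact ⟨Sum.inr ⟨c, by omega⟩, Fin.ext hc.symm⟩

theorem sum_fin_pairs_of_even {n : ℕ} (hn : Even n) {A : Type*} [AddCommMonoid A]
    (f : Fin n → A) : ∑ i, f i = ∑ k : Fin (n / 2), (f (idxOdd k) + f (idxEven k)) :=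
  sum_fin_pairs f fun i hi => by
    obtain ⟨c, hc⟩ := hn
    omega

theorem idxOdd_ne_idxEven {n : ℕ} (s t : Fin (n / 2)) : idxOdd s ≠ idxEven t := by
  simp only [idxOdd, idxEven, ne_eq, Fin.mk.injEq]
  omega

theorem idxOdd_injective {n : ℕ} : Function.Injective (idxOdd : Fin (n / 2) → Fin n) := by
  intro s t h
  simp only [idxOdd, Fin.mk.injEq] at h
  exact Fin.ext (by omega)

theorem idxEven_injective {n : ℕ} : Function.Injective (idxEven : Fin (n / 2) → Fin n) := by
  intro s t h
  simp only [idxEven, Fin.mk.injEq] at h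
  exact Fin.ext (by omega)

theorem update_zero_comp_succ {R : Type*} {m : ℕ} (f : Fin (m + 1) → R) (y : R) :
    (fun i : Fin m => Function.update f 0 y i.succ) = fun i => f i.succ := by
  funext i
  simp

theorem update_succ_comp_succ {R : Type*} {m : ℕ} (f : Fin (m + 1) → R) (s : Fin m) (y : R) :
    (fun i : Fin m => Function.update f s.succ y i.succ) =
      Function.update (fun i => f i.succ) s y := by
  funext i
  simp [Function.update_apply]

section OrderedProducts

variable {R : Type*} [Ring R] {m : ℕ}

theorem prod_ofFn_update_zero (f : Fin (m + 1) → R) (y : R) :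
    (List.ofFn (Function.update f 0 y)).prod = y * (List.ofFn fun i : Fin m => f i.succ).prod := by
  rw [List.ofFn_succ, List.prod_cons, update_zero_comp_succ, Function.update_self]

theorem prod_ofFn_update_succ (f : Fin (m + 1) → R) (s : Fin m) (y : R) :
    (List.ofFn (Function.update f s.succ y)).prod =
      f 0 * (List.ofFn (Function.update (fun i : Fin m => f i.succ) s y)).prod := by
  rw [List.ofFn_succ, List.prod_cons, update_succ_comp_succ,
    Function.update_of_ne (Fin.succ_ne_zero s).symm]

/-- The Leibniz rule for the derivation `[a, ·]` on an ordered product. -/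
theorem commutator_prod_ofFn (a : R) (f : Fin m → R) :
    a * (List.ofFn f).prod - (List.ofFn f).prod * a =
      ∑ s, (List.ofFn (Function.update f s (a * f s - f s * a))).prod := by
  induction m with
  | zero => simp
  | succ m ih =>
    rw [Fin.sum_univ_succ, prod_ofFn_update_zero]
    simp only [prod_ofFn_update_succ]
    rw [← Finset.mul_sum, ← ih, List.ofFn_succ, List.prod_cons]
    noncomm_ring

theorem commute_prod_ofFn {y : R} {f : Fin m → R} (h : ∀ t, Commute y (f t)) :
    Commute y (List.ofFn f).prod :=
  Commute.list_prod_right _ _ fun z hz => by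
    obtain ⟨t, rfl⟩ := List.mem_ofFn.1 hz
    exact h t

theorem prod_ofFn_update {y : R} {f : Fin m → R} {s : Fin m} (h : ∀ t, t ≠ s → Commute y (f t)) :
    (List.ofFn (Function.update f s y)).prod =
      (List.ofFn (Function.update f s 1)).prod * y := by
  induction m with
  | zero => exact s.elim0
  | succ m ih =>
    cases s using Fin.cases with
    | zero =>
      rw [prod_ofFn_update_zero, prod_ofFn_update_zero, one_mul]
      exact (commute_prod_ofFn fun t => h t.succ (Fin.succ_ne_zero t)).eq
    | succ s =>
      rw [prod_ofFn_update_succ, prod_ofFn_update_succ, mul_assoc,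
        ih fun t ht => h t.succ fun h' => ht (Fin.succ_injective _ h')]

/-- In the expansion, any term with two factors from `g` vanishes once the `g`'s are moved together.
-/
theorem prod_ofFn_add {f g : Fin m → R} (hfg : ∀ s t, Commute (g s) (f t))
    (hg : ∀ s t, s ≠ t → g s * g t = 0) :
    (List.ofFn fun t => f t + g t).prod =
      (List.ofFn f).prod + ∑ s, (List.ofFn (Function.update f s (g s))).prod := by
  induction m with
  | zero => simp
  | succ m ih =>
    rw [List.ofFn_succ, List.prod_cons,
      ih (fun s t => hfg s.succ t.succ) fun s t hst =>
        hg _ _ fun h' => hst (Fin.succ_injective _ h'),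
      Fin.sum_univ_succ, prod_ofFn_update_zero, List.ofFn_succ (f := f), List.prod_cons]
    simp only [prod_ofFn_update_succ]
    have h0 : g 0 * ∑ s, (List.ofFn (Function.update (fun i : Fin m => f i.succ) s
        (g s.succ))).prod = 0 := by
      rw [Finset.mul_sum]
      refine Finset.sum_eq_zero fun s _ => ?_
      rw [prod_ofFn_update fun t _ => hfg s.succ t.succ, ← mul_assoc,
        (commute_prod_ofFn fun t => ?_ : Commute (g 0) _).eq, mul_assoc,
        hg 0 s.succ (Fin.succ_ne_zero s).symm, mul_zero]
      rcases eq_or_ne t s with rfl | hts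
      · simp
      · rw [Function.update_of_ne hts]
        exact hfg _ _
    rw [add_mul, mul_add, mul_add, h0, Finset.mul_sum]
    abel

end OrderedProducts

/-! ### The Pfaffian -/

section Pfaffian

variable {n : ℕ} {R : Type*} [Ring R]

/-- The ordered product over the coordinate planes of the entries with the given indices. -/
def planeProd (x : Fin n → Fin n → R) (ι : Fin n → Fin n) : R :=
  (List.ofFn fun k : Fin (n / 2) => x (ι (idxOdd k)) (ι (idxEven k))).prod

/-- The Pfaffian of a matrix with entries in an associative algebra. -/
def pfaffian [Algebra ℂ R] (x : Fin n → Fin n → R) : R :=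
  (Complex.I ^ (n / 2) * 2 ^ (n / 2) * ((n / 2).factorial : ℂ))⁻¹ •
    ∑ σ : Equiv.Perm (Fin n), ((Equiv.Perm.sign σ : ℤ) : ℂ) • planeProd x σ

/-- For even `n` the planes permuted by `σ` partition the indices, so exactly one of them contains
`a`. -/
theorem sum_ite_plane (hn : Even n) (σ : Equiv.Perm (Fin n)) (a : Fin n) (z : R) :
    ∑ s : Fin (n / 2), (if σ (idxOdd s) = a ∨ σ (idxEven s) = a then z else 0) = z := by
  have h : ∀ s : Fin (n / 2), (if σ (idxOdd s) = a ∨ σ (idxEven s) = a then z else 0) =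
      (if idxOdd s = σ.symm a then z else 0) + (if idxEven s = σ.symm a then z else 0) := by
    intro s
    simp only [← Equiv.eq_symm_apply]
    by_cases h1 : idxOdd s = σ.symm a
    · have h2 : idxEven s ≠ σ.symm a := fun h2 => idxOdd_ne_idxEven s s (h1.trans h2.symm)
      simp [h1, h2]
    · simp [h1]
  simp only [h]
  rw [← sum_fin_pairs_of_even hn fun i => if i = σ.symm a then z else 0]
  simp

/-- `[e_{ab}, ·]` is a derivation that replaces an index `a` by `b`, minus the reverse. Each index
occurs in exactly one factor, so each replacement yields one product. -/
theorem bracket_planeProd [Algebra ℂ R] (hn : Even n) {x : Fin n → Fin n → R} (hx : SoRel x)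
    {a b : Fin n} (hab : a ≠ b) (σ : Equiv.Perm (Fin n)) :
    x a b * planeProd x σ - planeProd x σ * x a b =
      planeProd x (Function.update id a b ∘ σ) - planeProd x (Function.update id b a ∘ σ) := by
  have hbr : ∀ i j, i ≠ j → x a b * x i j - x i j * x a b =
      (if i = a ∨ j = a then x (Function.update id a b i) (Function.update id a b j) else 0) -
      (if i = b ∨ j = b then x (Function.update id b a i) (Function.update id b a j) else 0) := by
    intro i j hij
    rw [hx.bracket]
    by_cases h1 : i = a
    · subst h1
      by_cases h2 : j = b
      · subst h2
        simp [hab, hab.symm]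
      · simp [hab, hab.symm, h2, hij, hij.symm, Ne.symm h2]
    · by_cases h2 : i = b
      · subst h2
        by_cases h3 : j = a
        · subst h3
          simp [hab, hab.symm, add_comm, sub_eq_add_neg]
        · simp [hab, hab.symm, h3, Ne.symm h3, hij, hij.symm]
      · by_cases h3 : j = a
        · subst h3
          simp [hab, hab.symm, h1, h2, Ne.symm h1, Ne.symm h2]
        · by_cases h4 : j = b
          · subst h4
            simp [hab, hab.symm, h1, h2, Ne.symm h1, Ne.symm h2]
          · simp [h1, h2, h3, h4, Ne.symm h1, Ne.symm h2, Ne.symm h3, Ne.symm h4]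
  have key : ∀ a b : Fin n, ∀ s : Fin (n / 2),
      (List.ofFn (Function.update (fun k : Fin (n / 2) => x (σ (idxOdd k)) (σ (idxEven k))) s
        (if σ (idxOdd s) = a ∨ σ (idxEven s) = a then
          x (Function.update id a b (σ (idxOdd s))) (Function.update id a b (σ (idxEven s)))
          else 0))).prod =
      if σ (idxOdd s) = a ∨ σ (idxEven s) = a then planeProd x (Function.update id a b ∘ σ)
        else 0 := by
    intro a b s
    split_ifs with h
    · rw [planeProd]
      congr 2
      funext t
      rcases eq_or_ne t s with rfl | hts
      · simp
      · have h1 : σ (idxOdd t) ≠ a ∧ σ (idxEven t) ≠ a := by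
          rcases h with rfl | rfl
          · exact ⟨fun h' => hts (idxOdd_injective (σ.injective h')),
              fun h' => idxOdd_ne_idxEven s t (σ.injective h').symm⟩
          · exact ⟨fun h' => idxOdd_ne_idxEven t s (σ.injective h'),
              fun h' => hts (idxEven_injective (σ.injective h'))⟩
        simp [Function.update_of_ne hts, Function.update_of_ne h1.1, Function.update_of_ne h1.2]
    -- The ordered product is multilinear in its factors, so a zero factor kills it.
    · exact (MultilinearMap.mkPiAlgebraFin ℂ (n / 2) R).map_update_zero _ s
  have hsub : ∀ (f : Fin (n / 2) → R) (s : Fin (n / 2)) (u v : R),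
      (List.ofFn (Function.update f s (u - v))).prod =
        (List.ofFn (Function.update f s u)).prod - (List.ofFn (Function.update f s v)).prod :=
    fun f s u v => (MultilinearMap.mkPiAlgebraFin ℂ (n / 2) R).map_update_sub f s u v
  have h0 := commutator_prod_ofFn (x a b)
    fun k : Fin (n / 2) => x (σ (idxOdd k)) (σ (idxEven k))
  rw [← planeProd] at h0
  rw [h0]
  have h1 : ∀ s : Fin (n / 2), σ (idxOdd s) ≠ σ (idxEven s) := fun s h =>
    idxOdd_ne_idxEven s s (σ.injective h)
  simp only [hbr _ _ (h1 _), hsub, key, Finset.sum_sub_distrib, sum_ite_plane hn]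

/-- After the replacement `a` and `b` are indistinguishable, so `σ` and `swap a b * σ` give the same
product with opposite signs. -/
theorem sum_sign_planeProd_update [Algebra ℂ R] (x : Fin n → Fin n → R) {a b : Fin n}
    (hab : a ≠ b) :
    ∑ σ : Equiv.Perm (Fin n), ((Equiv.Perm.sign σ : ℤ) : ℂ) •
      planeProd x (Function.update id a b ∘ σ) = 0 := by
  refine Finset.sum_involution (fun σ _ => Equiv.swap a b * σ) (fun σ _ => ?_) (fun σ _ _ h => ?_)
    (fun _ _ => Finset.mem_univ _) fun σ _ => ?_
  · have : Function.update id a b ∘ ⇑(Equiv.swap a b * σ) = Function.update id a b ∘ ⇑σ := by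
      funext i
      simp only [Function.comp_apply, Equiv.Perm.mul_apply]
      by_cases h1 : σ i = a
      · simp [h1, Function.update_apply]
      · by_cases h2 : σ i = b
        · simp [h2, Function.update_apply]
        · rw [Equiv.swap_apply_of_ne_of_ne h1 h2]
    rw [this, ← add_smul]
    simp [Equiv.Perm.sign_swap hab]
  · exact hab (Equiv.swap_eq_one_iff.1 (mul_eq_right.1 h))
  · simp [← mul_assoc]

theorem SoRel.self_eq_zero [Algebra ℂ R] {x : Fin n → Fin n → R} (hx : SoRel x) (a : Fin n) :
    x a a = 0 := by
  have h : (2 : ℂ) • x a a = 0 := by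
    rw [two_smul]
    nth_rewrite 1 [hx.skew a a]
    simp
  exact (smul_eq_zero_iff_right two_ne_zero).1 h

theorem SoRel.commute_pfaffian [Algebra ℂ R] (hn : Even n) {x : Fin n → Fin n → R}
    (hx : SoRel x) (a b : Fin n) : Commute (x a b) (pfaffian x) := by
  rcases eq_or_ne a b with rfl | hab
  · rw [hx.self_eq_zero]
    exact Commute.zero_left _
  refine Commute.smul_right ?_ _
  refine sub_eq_zero.1 ?_
  simp only [Finset.mul_sum, Finset.sum_mul, ← Finset.sum_sub_distrib, mul_smul_comm,
    smul_mul_assoc, ← smul_sub, bracket_planeProd hn hx hab]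
  simp only [smul_sub, Finset.sum_sub_distrib, sum_sign_planeProd_update x hab,
    sum_sign_planeProd_update x hab.symm, sub_zero]

/-- The part of the Pfaffian of a tensor product that acts on the natural representation. -/
def pfaffianLinear [Algebra ℂ R] (x : Fin n → Fin n → R) : Matrix (Fin n) (Fin n) R :=
  (Complex.I ^ (n / 2) * 2 ^ (n / 2) * ((n / 2).factorial : ℂ))⁻¹ •
    ∑ σ : Equiv.Perm (Fin n), ((Equiv.Perm.sign σ : ℤ) : ℂ) •
      ∑ s : Fin (n / 2), Matrix.scalar (Fin n) (List.ofFn (Function.update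
        (fun k : Fin (n / 2) => x (σ (idxOdd k)) (σ (idxEven k))) s 1)).prod *
          skewUnit R (σ (idxOdd s)) (σ (idxEven s))

theorem commute_skewUnit_scalar (i j : Fin n) (z : R) :
    Commute (skewUnit R i j) (Matrix.scalar (Fin n) z) := by
  ext k l
  simp only [Matrix.scalar_apply, Matrix.mul_diagonal, Matrix.diagonal_mul, skewUnit_apply]
  split_ifs <;> simp

theorem soRel_skewUnit : SoRel (skewUnit R (n := n)) where
  skew := skewUnit_swap
  bracket i j k l := by
    have hm : ∀ a b c d : Fin n, Matrix.single a b (1 : R) * Matrix.single c d 1 =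
        if b = c then Matrix.single a d 1 else 0 := by
      intro a b c d
      split_ifs with hbc
      · subst hbc
        simp
      · exact Matrix.single_mul_single_of_ne _ _ _ _ hbc _
    simp only [skewUnit, sub_mul, mul_sub, hm, eq_comm (a := k), eq_comm (a := l)]
    split_ifs <;> abel

theorem SoRel.tensorGen {x : Fin n → Fin n → R} (hx : SoRel x) : SoRel (tensorGen x) where
  skew i j := by
    rw [CliffordHom.tensorGen, CliffordHom.tensorGen, skewUnit_swap, hx.skew, map_neg, neg_add]
  bracket i j k l := by
    have h : CliffordHom.tensorGen x i j * CliffordHom.tensorGen x k l -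
        CliffordHom.tensorGen x k l * CliffordHom.tensorGen x i j =
          Matrix.scalar (Fin n) (x i j * x k l - x k l * x i j) +
            (skewUnit R i j * skewUnit R k l - skewUnit R k l * skewUnit R i j) := by
      simp only [CliffordHom.tensorGen, mul_add, add_mul, map_sub, map_mul,
        (commute_skewUnit_scalar _ _ _).eq]
      abel
    rw [h, hx.bracket, soRel_skewUnit.bracket]
    simp only [CliffordHom.tensorGen, map_sub, map_add, apply_ite (Matrix.scalar (Fin n)), map_zero]
    split_ifs <;> abel

/-- Distinct planes of `σ` have disjoint indices, so the product of their `skewUnit`s is zero, and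
at most one factor can act on the natural representation. -/
theorem pfaffian_tensorGen [Algebra ℂ R] (x : Fin n → Fin n → R) :
    pfaffian (tensorGen x) = Matrix.scalar (Fin n) (pfaffian x) + pfaffianLinear x := by
  have h : ∀ σ : Equiv.Perm (Fin n), planeProd (tensorGen x) σ =
      Matrix.scalar (Fin n) (planeProd x σ) + ∑ s : Fin (n / 2),
        Matrix.scalar (Fin n) (List.ofFn (Function.update
          (fun k : Fin (n / 2) => x (σ (idxOdd k)) (σ (idxEven k))) s 1)).prod *
            skewUnit R (σ (idxOdd s)) (σ (idxEven s)) := by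
    intro σ
    unfold planeProd tensorGen
    rw [prod_ofFn_add (fun s t => commute_skewUnit_scalar _ _ _), map_list_prod, List.map_ofFn]
    · congr 1
      refine Finset.sum_congr rfl fun s _ => ?_
      rw [prod_ofFn_update fun t _ => commute_skewUnit_scalar _ _ _, map_list_prod, List.map_ofFn]
      congr 3
      funext t
      rcases eq_or_ne t s with rfl | hts
      · simp
      · simp [Function.update_of_ne hts]
    · intro s t hst
      have h1 : σ (idxOdd s) ≠ σ (idxOdd t) := fun h => hst (idxOdd_injective (σ.injective h))
      have h2 : σ (idxEven s) ≠ σ (idxEven t) := fun h => hst (idxEven_injective (σ.injective h))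
      have h3 : σ (idxOdd s) ≠ σ (idxEven t) := fun h => idxOdd_ne_idxEven s t (σ.injective h)
      have h4 : σ (idxEven s) ≠ σ (idxOdd t) := fun h =>
        idxOdd_ne_idxEven t s (σ.injective h).symm
      simp [skewUnit, sub_mul, mul_sub, Matrix.single_mul_single_of_ne, h1, h2, h3, h4]
  have hs : ∀ (c : ℂ) (z : R), Matrix.scalar (Fin n) (c • z) = c • Matrix.scalar (Fin n) z :=
    fun c z => by
      ext k l
      simp [Matrix.scalar_apply, Matrix.diagonal_apply]
  simp only [pfaffian, pfaffianLinear, h, hs, map_sum, smul_add, Finset.sum_add_distrib]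

theorem pfaffianLinear_transpose [Algebra ℂ R] (x : Fin n → Fin n → R) :
    (pfaffianLinear x).transpose = -pfaffianLinear x := by
  have h : ∀ (z : R) (i j : Fin n), (Matrix.scalar (Fin n) z * skewUnit R i j).transpose =
      -(Matrix.scalar (Fin n) z * skewUnit R i j) := by
    intro z i j
    ext k l
    simp only [Matrix.transpose_apply, Matrix.neg_apply, Matrix.scalar_apply, Matrix.diagonal_mul,
      skewUnit_apply]
    split_ifs <;> simp
  simp only [pfaffianLinear, Matrix.transpose_smul, Matrix.transpose_sum, h, Finset.sum_neg_distrib,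
    smul_neg]

/-- For each `σ`, only the plane containing `k` contributes to the diagonal entry. Multiplication by
`E` supplies the missing factor of that plane, which commutes with the others and can be returned to
its slot. -/
theorem SoRel.pfaffianLinear_mul_diag [Algebra ℂ R] (hn : Even n) {x : Fin n → Fin n → R}
    (hx : SoRel x) (k : Fin n) : (pfaffianLinear x * Matrix.of x) k k = pfaffian x := by
  have h1 : ∀ (z : R) (i j : Fin n), i ≠ j →
      (Matrix.scalar (Fin n) z * skewUnit R i j * Matrix.of x) k k =
        if i = k ∨ j = k then z * x i j else 0 := by
    intro z i j hij
    rw [mul_assoc, Matrix.scalar_apply, Matrix.diagonal_mul]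
    simp only [Matrix.mul_apply, skewUnit_apply, sub_mul, Finset.sum_sub_distrib, ite_mul,
      one_mul, zero_mul, Matrix.of_apply]
    by_cases h1 : i = k
    · subst h1
      simp [hij.symm, hx.skew i j]
    · by_cases h2 : j = k
      · subst h2
        simp [hij]
      · simp [h1, h2]
  have h2 : ∀ (σ : Equiv.Perm (Fin n)) (s : Fin (n / 2)), (List.ofFn (Function.update
      (fun k : Fin (n / 2) => x (σ (idxOdd k)) (σ (idxEven k))) s 1)).prod *
        x (σ (idxOdd s)) (σ (idxEven s)) = planeProd x σ := by
    intro σ s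
    rw [← prod_ofFn_update (f := fun k : Fin (n / 2) => x (σ (idxOdd k)) (σ (idxEven k))),
      planeProd]
    · congr 2
      exact Function.update_eq_self s _
    · intro t hts
      have h1 : σ (idxOdd s) ≠ σ (idxOdd t) := fun h =>
        hts (idxOdd_injective (σ.injective h)).symm
      have h2 : σ (idxEven s) ≠ σ (idxEven t) := fun h =>
        hts (idxEven_injective (σ.injective h)).symm
      have h3 : σ (idxOdd s) ≠ σ (idxEven t) := fun h => idxOdd_ne_idxEven s t (σ.injective h)
      have h4 : σ (idxEven s) ≠ σ (idxOdd t) := fun h =>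
        idxOdd_ne_idxEven t s (σ.injective h).symm
      refine sub_eq_zero.1 ?_
      rw [hx.bracket]
      simp [h1, h2, h3, h4]
  have h3 : ∀ (σ : Equiv.Perm (Fin n)) (s : Fin (n / 2)), σ (idxOdd s) ≠ σ (idxEven s) :=
    fun σ s h => idxOdd_ne_idxEven s s (σ.injective h)
  simp only [pfaffianLinear, pfaffian, smul_mul_assoc, Finset.sum_mul, Matrix.smul_apply,
    Matrix.sum_apply, h1 _ _ _ (h3 _ _), h2, sum_ite_plane hn]

end Pfaffian

/-! ### Representations -/

section Representation

variable (n : ℕ) (M : Type*) [AddCommGroup M] [Module ℂ M] [LieRingModule (SO n) M]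
  [LieModule ℂ (SO n) M]

/-- The action of `e_{ij}` on a representation. -/
def gen (i j : Fin n) : Module.End ℂ M :=
  LieModule.toEnd ℂ (SO n) M (e n i j)

variable {n M}

theorem gen_apply (i j : Fin n) (v : M) : gen n M i j v = ⁅e n i j, v⁆ := rfl

theorem e_skew (i j : Fin n) : e n j i = -e n i j := by
  ext1
  simp [e]

theorem e_bracket (i j k l : Fin n) : ⁅e n i j, e n k l⁆ =
    (if i = k then e n j l else 0) - (if j = k then e n i l else 0) +
      (if i = l then e n k j else 0) - (if j = l then e n k i else 0) := by
  ext1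
  have h : ∀ (P : Prop) [Decidable P] (y : SO n), ((if P then y else 0 : SO n) :
      Matrix (Fin n) (Fin n) ℂ) = if P then (y : Matrix (Fin n) (Fin n) ℂ) else 0 := by
    intro P _ y
    split_ifs <;> rfl
  have hm : ∀ a b c d : Fin n, Matrix.single a b (1 : ℂ) * Matrix.single c d 1 =
      if b = c then Matrix.single a d 1 else 0 := by
    intro a b c d
    split_ifs with hbc
    · subst hbc
      simp
    · exact Matrix.single_mul_single_of_ne _ _ _ _ hbc _
  simp only [LieSubalgebra.coe_bracket, LieRing.of_associative_ring_bracket, AddSubgroupClass.coe_sub,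
    AddMemClass.coe_add, h]
  simp only [e, sub_mul, mul_sub, hm, eq_comm (a := k), eq_comm (a := l)]
  split_ifs <;> abel

theorem soRel_gen : SoRel (gen n M) where
  skew i j := by simp only [gen, e_skew i j, map_neg]
  bracket i j k l := by
    have := congrArg (LieModule.toEnd ℂ (SO n) M) (e_bracket i j k l)
    rw [LieHom.map_lie, LieRing.of_associative_ring_bracket] at this
    simp only [gen, this, map_sub, map_add, apply_ite (LieModule.toEnd ℂ (SO n) M), map_zero]

/-- The factor `-1/2`: each pair of indices is counted twice, and `e_{ij}` has entry `-1` at `(i,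
j)`. -/
theorem eq_sum_e (X : SO n) : X = (-(1 / 2) : ℂ) • ∑ i, ∑ j, X.1 i j • e n i j := by
  have hX : X.1.transpose = -X.1 := (LieAlgebra.Orthogonal.mem_so _ _ _).1 X.2
  ext k l
  have hkl : X.1 l k = -X.1 k l := congrFun (congrFun hX k) l
  have h : ((∑ i, ∑ j, X.1 i j • e n i j : SO n) : Matrix (Fin n) (Fin n) ℂ) =
      ∑ i, ∑ j, X.1 i j • (Matrix.single j i 1 - Matrix.single i j 1) := by
    simp only [AddSubmonoidClass.coe_finsetSum]
    rfl
  change X.1 k l = ((-(1 / 2) : ℂ) •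
    ((∑ i, ∑ j, X.1 i j • e n i j : SO n) : Matrix (Fin n) (Fin n) ℂ)) k l
  rw [h]
  simp only [Matrix.smul_apply, Matrix.sum_apply, Matrix.sub_apply, Matrix.single_apply, ite_and,
    smul_eq_mul, mul_sub, Finset.sum_sub_distrib]
  simp [hkl]
  ring

theorem lie_mem_of_gen {E : Submodule ℂ M} {v : M} (h : ∀ i j, gen n M i j v ∈ E) (X : SO n) :
    ⁅X, v⁆ ∈ E := by
  have : ⁅X, v⁆ = (-(1 / 2) : ℂ) • ∑ i, ∑ j, X.1 i j • gen n M i j v := by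
    change LieModule.toEnd ℂ (SO n) M X v = _
    conv_lhs => rw [eq_sum_e X]
    simp [gen]
  rw [this]
  exact E.smul_mem _ (E.sum_mem fun i _ => E.sum_mem fun j _ => E.smul_mem _ (h i j))

/-- A subspace stable under all `e_{ij}`, as a submodule. -/
def submoduleOfGen (E : Submodule ℂ M) (h : ∀ i j, ∀ v ∈ E, gen n M i j v ∈ E) :
    LieSubmodule ℂ (SO n) M where
  __ := E
  lie_mem {X v} hv := lie_mem_of_gen (E := E) (fun i j => h i j v hv) X

theorem gen_mem (W : LieSubmodule ℂ (SO n) M) (i j : Fin n) {v : M} (hv : v ∈ W) :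
    gen n M i j v ∈ W :=
  W.lie_mem hv

theorem act_ι (X : SO n) : act n M (UniversalEnvelopingAlgebra.ι ℂ X) =
    LieModule.toEnd ℂ (SO n) M X :=
  UniversalEnvelopingAlgebra.lift_ι_apply ℂ _ X

theorem act_pf : act n M (pf n) = pfaffian (gen n M) := by
  simp only [pf, pfaffian, planeProd, map_smul, map_sum, map_list_prod, List.map_ofFn,
    Function.comp_def, act_ι, gen]

theorem map_pfaffian {R S : Type*} [Ring R] [Ring S] [Algebra ℂ R] [Algebra ℂ S] (f : R →ₐ[ℂ] S)
    (x : Fin n → Fin n → R) : f (pfaffian x) = pfaffian fun i j => f (x i j) := by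
  simp only [pfaffian, planeProd, map_smul, map_sum, map_list_prod, List.map_ofFn,
    Function.comp_def]

theorem act_cHat (q : ℕ) : act n M (cHat n q) =
    ((Matrix.of (gen n M) + algebraMap ℂ _ (((n : ℂ) - 1) / 2)) ^ q).trace := by
  have h : (act n M).toRingHom.mapMatrix (eHat n) =
      Matrix.of (gen n M) + algebraMap ℂ _ (((n : ℂ) - 1) / 2) := by
    ext1 i j
    simp only [eHat, RingHom.mapMatrix_apply, Matrix.map_apply, Matrix.of_apply, Matrix.add_apply,
      AlgHom.toRingHom_eq_coe, RingHom.coe_coe, map_add, act_ι, AlgHom.commutes,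
      Matrix.algebraMap_matrix_apply]
    congr 1
    split_ifs <;> simp
  rw [← h, ← map_pow, cHat, map_sum]
  rfl

/-- The action of the enveloping algebra commutes with the inclusion of a submodule. -/
theorem coe_act (W : LieSubmodule ℂ (SO n) M) (z : U n) (w : W) :
    ((act n W z w : W) : M) = act n M z (w : M) := by
  -- The elements for which the claim holds form a subalgebra containing `𝔰𝔬(n)`. Lifting the
  -- inclusion into it and using the universal property shows that it is everything.
  let S : Subalgebra ℂ (U n) :=
    { carrier := {z | ∀ w : W, ((act n W z w : W) : M) = act n M z (w : M)}
      mul_mem' := fun {a b} ha hb w => by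
        rw [map_mul, map_mul, Module.End.mul_apply, Module.End.mul_apply, ha, hb]
      add_mem' := fun {a b} ha hb w => by
        rw [map_add, map_add, LinearMap.add_apply, LinearMap.add_apply, ← ha, ← hb]
        rfl
      algebraMap_mem' := fun c w => by
        rw [AlgHom.commutes, AlgHom.commutes]
        rfl }
  have hι : ∀ X, UniversalEnvelopingAlgebra.ι ℂ X ∈ S := fun X w => by
    rw [act_ι, act_ι]
    rfl
  let f : SO n →ₗ⁅ℂ⁆ S :=
    { toFun := fun X => ⟨UniversalEnvelopingAlgebra.ι ℂ X, hι X⟩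
      map_add' := fun X Y => Subtype.ext (map_add _ X Y)
      map_smul' := fun c X => Subtype.ext (map_smul _ c X)
      map_lie' := fun {X Y} => Subtype.ext (LieHom.map_lie _ X Y) }
  have hf : S.val.comp (UniversalEnvelopingAlgebra.lift ℂ f) = AlgHom.id ℂ (U n) := by
    refine UniversalEnvelopingAlgebra.hom_ext ℂ (LieHom.ext fun X => ?_)
    change ((UniversalEnvelopingAlgebra.lift ℂ f (UniversalEnvelopingAlgebra.ι ℂ X) : S) : U n) = _
    rw [UniversalEnvelopingAlgebra.lift_ι_apply]
    rfl
  have hz : ((UniversalEnvelopingAlgebra.lift ℂ f z : S) : U n) = z := DFunLike.congr_fun hf z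
  have := (UniversalEnvelopingAlgebra.lift ℂ f z : S).2
  rw [hz] at this
  exact this w

end Representation

/-! ### Irreducible submodules. -/

section Irreducible

variable {n : ℕ} {M : Type*} [AddCommGroup M] [Module ℂ M] [LieRingModule (SO n) M]

theorem eq_of_le_irreducible {W N : LieSubmodule ℂ (SO n) M}
    (hW : LieModule.IsIrreducible ℂ (SO n) W) (hN : N ≤ W) (h0 : N ≠ ⊥) : N = W := by
  rcases hW.eq_bot_or_eq_top (N.comap W.incl) with h | h
  · refine absurd (eq_bot_iff.2 fun v hv => ?_) h0
    have hv' : (⟨v, hN hv⟩ : W) ∈ N.comap W.incl := hv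
    rw [h, LieSubmodule.mem_bot] at hv'
    exact (LieSubmodule.mem_bot v).2 (congrArg Subtype.val hv')
  · refine le_antisymm hN fun v hv => ?_
    have hv' : (⟨v, hv⟩ : W) ∈ N.comap W.incl := h ▸ LieSubmodule.mem_top _
    exact hv'

theorem ne_bot_of_isIrreducible {W : LieSubmodule ℂ (SO n) M}
    (hW : LieModule.IsIrreducible ℂ (SO n) W) : W ≠ ⊥ := by
  have : Nontrivial W := LieModule.nontrivial_of_isIrreducible ℂ (SO n) W
  exact (LieSubmodule.nontrivial_iff_ne_bot ℂ (SO n) M).1 this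

/-- A minimal nonzero submodule exists because the lattice of submodules is Artinian. -/
theorem exists_irreducible_le [FiniteDimensional ℂ M] {N : LieSubmodule ℂ (SO n) M} (h : N ≠ ⊥) :
    ∃ W ≤ N, LieModule.IsIrreducible ℂ (SO n) W := by
  have : IsAtomic (LieSubmodule ℂ (SO n) M) :=
    isAtomic_of_orderBot_wellFounded_lt (LieSubmodule.wellFoundedLT_of_isArtinian ℂ (SO n) M).wf
  obtain ⟨W, hW, hWN⟩ := (eq_bot_or_exists_atom_le N).resolve_left h
  refine ⟨W, hWN, ?_⟩
  have : Nontrivial W := (LieSubmodule.nontrivial_iff_ne_bot ℂ (SO n) M).2 hW.1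
  refine LieModule.IsIrreducible.mk fun K hK => ?_
  have hle : K.map W.incl ≤ W := by
    intro v hv
    obtain ⟨w, -, rfl⟩ := (LieSubmodule.mem_map v).1 hv
    exact w.2
  rcases hW.le_iff.1 hle with h' | h'
  · refine absurd (eq_bot_iff.2 fun v hv => ?_) hK
    have : W.incl v ∈ K.map W.incl := LieSubmodule.mem_map_of_mem hv
    rw [h', LieSubmodule.mem_bot] at this
    exact (LieSubmodule.mem_bot v).2 (Subtype.ext this)
  · refine eq_top_iff.2 fun v _ => ?_
    have hv : (v : M) ∈ K.map W.incl := by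
      rw [h']
      exact v.2
    obtain ⟨w, hw, hwv⟩ := (LieSubmodule.mem_map _).1 hv
    exact (Subtype.ext hwv : w = v) ▸ hw

end Irreducible

/-! ### Matrices of operators on a tensor product with the natural representation -/

section Tensor

variable {n : ℕ} {V : Type*} [AddCommGroup V] [Module ℂ V]

/-- The matrix unit `u ↦ u_l ε_k` on `ℂⁿ`. -/
def matUnit (k l : Fin n) : Cn n →ₗ[ℂ] Cn n where
  toFun u := u l • EuclideanSpace.single k 1
  map_add' u v := by simp [add_smul]
  map_smul' c u := by simp [mul_smul]

theorem matUnit_comp (k l k' l' : Fin n) :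
    matUnit k l ∘ₗ matUnit k' l' = if l = k' then matUnit k l' else 0 := by
  ext u i
  by_cases h : l = k' <;> simp [matUnit, h]

variable (V) in
/-- The operator on `V ⊗ ℂⁿ` given by a matrix of operators on `V`. -/
def opLinear (n : ℕ) : Matrix (Fin n) (Fin n) (Module.End ℂ V) →ₗ[ℂ]
    Module.End ℂ (V ⊗[ℂ] Cn n) where
  toFun A := ∑ k, ∑ l, TensorProduct.map (A k l) (matUnit k l)
  map_add' A B := by
    simp only [Matrix.add_apply, TensorProduct.map_add_left, Finset.sum_add_distrib]
  map_smul' c A := by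
    simp only [Matrix.smul_apply, TensorProduct.map_smul_left, Finset.smul_sum, RingHom.id_apply]

theorem opLinear_tmul (A : Matrix (Fin n) (Fin n) (Module.End ℂ V)) (φ : V) (u : Cn n) :
    opLinear V n A (φ ⊗ₜ u) =
      ∑ k, ∑ l, A k l φ ⊗ₜ (u l • EuclideanSpace.single k (1 : ℂ) : Cn n) := by
  simp [opLinear, LinearMap.sum_apply, matUnit]

variable (V) in
/-- The algebra map from matrices of operators on `V` to operators on `V ⊗ ℂⁿ`. -/
def op (n : ℕ) : Matrix (Fin n) (Fin n) (Module.End ℂ V) →ₐ[ℂ] Module.End ℂ (V ⊗[ℂ] Cn n) :=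
  AlgHom.ofLinearMap (opLinear V n)
    (by
      refine TensorProduct.ext' fun φ u => ?_
      rw [opLinear_tmul]
      have : ∀ k l, ((1 : Matrix (Fin n) (Fin n) (Module.End ℂ V)) k l) φ ⊗ₜ[ℂ]
          (u l • EuclideanSpace.single k (1 : ℂ) : Cn n) =
          if k = l then φ ⊗ₜ (u l • EuclideanSpace.single k (1 : ℂ) : Cn n) else 0 := by
        intro k l
        rcases eq_or_ne k l with rfl | h
        · simp
        · simp [h]
      simp only [this, Finset.sum_ite_eq, Finset.mem_univ, if_true, ← TensorProduct.tmul_sum]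
      rw [Module.End.one_apply]
      congr 1
      ext i
      simp [Finset.sum_apply, Pi.single_apply])
    (by
      intro A B
      simp only [opLinear, LinearMap.coe_mk, AddHom.coe_mk, Finset.sum_mul, Finset.mul_sum,
        Module.End.mul_eq_comp, ← TensorProduct.map_comp, matUnit_comp, Matrix.mul_apply]
      simp only [apply_ite (TensorProduct.map (_ : Module.End ℂ V)), TensorProduct.map_zero_right,
        ← Module.End.mul_eq_comp]
      have hs : ∀ k l, TensorProduct.map (∑ p, A k p * B p l) (matUnit k l) =
          ∑ p, TensorProduct.map (A k p * B p l) (matUnit k l) := fun k l =>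
        TensorProduct.ext' fun φ u => by simp [LinearMap.sum_apply, TensorProduct.sum_tmul]
      simp only [hs, Finset.sum_ite_eq', Finset.mem_univ, if_true]
      rw [Finset.sum_comm]
      conv_rhs => rw [Finset.sum_comm]
      refine Finset.sum_congr rfl fun l _ => ?_
      rw [Finset.sum_comm])

theorem op_tmul (A : Matrix (Fin n) (Fin n) (Module.End ℂ V)) (φ : V) (u : Cn n) :
    op V n A (φ ⊗ₜ u) =
      ∑ k, ∑ l, A k l φ ⊗ₜ (u l • EuclideanSpace.single k (1 : ℂ) : Cn n) :=
  opLinear_tmul A φ u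

variable [LieRingModule (SO n) V] [LieModule ℂ (SO n) V]

theorem op_tensorGen (i j : Fin n) :
    op V n (tensorGen (gen n V) i j) = gen n (V ⊗[ℂ] Cn n) i j := by
  refine TensorProduct.ext' fun φ u => ?_
  rw [gen_apply, TensorProduct.LieModule.lie_tmul_right, tensorGen, map_add, LinearMap.add_apply]
  congr 1
  · rw [op_tmul]
    have : ∀ k l, (Matrix.scalar (Fin n) (gen n V i j)) k l φ ⊗ₜ[ℂ]
        (u l • EuclideanSpace.single k (1 : ℂ) : Cn n) =
        if k = l then ⁅e n i j, φ⁆ ⊗ₜ (u l • EuclideanSpace.single k (1 : ℂ) : Cn n) else 0 := by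
      intro k l
      rcases eq_or_ne k l with rfl | h
      · simp [gen_apply]
      · simp [h]
    simp only [this, Finset.sum_ite_eq, Finset.mem_univ, if_true, ← TensorProduct.tmul_sum]
    congr 1
    ext i
    simp [Finset.sum_apply, Pi.single_apply]
  · rw [op_tmul]
    have : ∀ k l, (skewUnit (Module.End ℂ V) i j) k l φ = (skewUnit ℂ i j) k l • φ := by
      intro k l
      simp only [skewUnit_apply]
      split_ifs <;> simp
    simp only [this, TensorProduct.smul_tmul, ← TensorProduct.tmul_sum]
    congr 1
    ext k
    change _ = ((skewUnit ℂ i j).mulVec u.ofLp) k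
    simp [Finset.sum_apply, Pi.single_apply, Matrix.mulVec, dotProduct]

end Tensor

/-! ### Unitary representations -/

section Unitary

variable {n : ℕ} {M : Type*} [NormedAddCommGroup M] [InnerProductSpace ℂ M]
  [LieRingModule (SO n) M]

theorem e_im (i j k l : Fin n) : ((e n i j).1 k l).im = 0 := by
  simp only [e, Matrix.sub_apply, Matrix.single_apply]
  split_ifs <;> simp

theorem isUnitaryRep_natural (n : ℕ) : IsUnitaryRep n (Cn n) := by
  intro X hX v w
  have hs : ∀ i j, X.1 j i = -X.1 i j := fun i j =>
    congrFun (congrFun ((LieAlgebra.Orthogonal.mem_so _ _ _).1 X.2) i) j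
  have hr : ∀ i j, (starRingEnd ℂ) (X.1 i j) = X.1 i j := fun i j =>
    Complex.conj_eq_iff_im.2 (hX i j)
  have hb : ∀ u : Cn n, ⁅X, u⁆ = WithLp.toLp 2 (X.1.mulVec u.ofLp) := fun _ => rfl
  simp only [hb, PiLp.inner_apply, RCLike.inner_apply, Matrix.mulVec, dotProduct, map_sum, map_mul,
    hr, Finset.mul_sum, Finset.sum_mul]
  rw [Finset.sum_comm, ← Finset.sum_neg_distrib]
  refine Finset.sum_congr rfl fun i _ => ?_
  rw [← Finset.sum_neg_distrib]
  refine Finset.sum_congr rfl fun j _ => ?_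
  rw [hs i j]
  ring

theorem IsUnitaryRep.tensor {N : Type*} [NormedAddCommGroup N] [InnerProductSpace ℂ N]
    [LieRingModule (SO n) N] [LieModule ℂ (SO n) M] [LieModule ℂ (SO n) N]
    (hM : IsUnitaryRep n M) (hN : IsUnitaryRep n N) : IsUnitaryRep n (M ⊗[ℂ] N) := by
  intro X hX x y
  induction x using TensorProduct.induction_on with
  | zero => simp
  | add x₁ x₂ h₁ h₂ => rw [lie_add, inner_add_left, inner_add_left, h₁, h₂, neg_add]
  | tmul a b =>
    induction y using TensorProduct.induction_on with
    | zero => simp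
    | add y₁ y₂ h₁ h₂ => rw [lie_add, inner_add_right, inner_add_right, h₁, h₂, neg_add]
    | tmul c d =>
      simp only [TensorProduct.LieModule.lie_tmul_right, inner_add_left, inner_add_right,
        TensorProduct.inner_tmul, hM X hX, hN X hX]
      ring

variable [LieModule ℂ (SO n) M]

theorem IsUnitaryRep.inner_gen (hM : IsUnitaryRep n M) (i j : Fin n) (v w : M) :
    inner ℂ (gen n M i j v) w = -inner ℂ v (gen n M i j w) :=
  hM _ (e_im i j) v w

/-- The orthogonal complement of a submodule. -/
def orthLie (hM : IsUnitaryRep n M) (W : LieSubmodule ℂ (SO n) M) : LieSubmodule ℂ (SO n) M :=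
  submoduleOfGen W.toSubmoduleᗮ fun i j v hv => by
    intro u hu
    rw [eq_neg_of_add_eq_zero_right (add_eq_zero_iff_eq_neg.2 (hM.inner_gen i j u v)),
      neg_eq_zero]
    exact hv _ (gen_mem W i j hu)

theorem le_orthLie_comm {hM : IsUnitaryRep n M} {W W' : LieSubmodule ℂ (SO n) M} :
    W ≤ orthLie hM W' ↔ W' ≤ orthLie hM W :=
  ⟨fun h _ hv _ hu => inner_eq_zero_symm.1 (h hu _ hv),
    fun h _ hv _ hu => inner_eq_zero_symm.1 (h hu _ hv)⟩

theorem inf_orthLie (hM : IsUnitaryRep n M) (W : LieSubmodule ℂ (SO n) M) :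
    W ⊓ orthLie hM W = ⊥ := by
  rw [eq_bot_iff]
  rintro v ⟨h1, h2⟩
  exact (LieSubmodule.mem_bot v).2 (inner_self_eq_zero.1 (h2 v h1))

variable (n M) in
/-- The operator `-√-1 e_{2k-1,2k}`. -/
def cartan (k : Fin (n / 2)) : Module.End ℂ M :=
  -Complex.I • gen n M (idxOdd k) (idxEven k)

theorem cartan_isSymmetric (hM : IsUnitaryRep n M) (k : Fin (n / 2)) :
    (cartan n M k).IsSymmetric := by
  intro v w
  simp only [cartan, LinearMap.smul_apply, inner_smul_left, inner_smul_right, hM.inner_gen]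
  simp

theorem commute_cartan (k l : Fin (n / 2)) : Commute (cartan n M k) (cartan n M l) := by
  refine Commute.smul_left (Commute.smul_right ?_ _) _
  rcases eq_or_ne k l with rfl | hkl
  · exact Commute.refl _
  refine sub_eq_zero.1 ?_
  rw [soRel_gen.bracket]
  simp [idxOdd_ne_idxEven, (idxOdd_ne_idxEven _ _).symm, idxOdd_injective.ne hkl,
    idxEven_injective.ne hkl]

/-- A weight vector: a common eigenvector of the operators `-√-1 e_{2k-1,2k}`. -/
def IsWeightVector (ν : Fin (n / 2) → ℝ) (v : M) : Prop :=
  v ≠ 0 ∧ ∀ k, cartan n M k v = (ν k : ℂ) • v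

theorem isWeight_iff {ν : Fin (n / 2) → ℝ} : IsWeight n M ν ↔ ∃ v : M, IsWeightVector ν v :=
  Iff.rfl

theorem isWeight_lieSubmodule_iff {W : LieSubmodule ℂ (SO n) M} {ν : Fin (n / 2) → ℝ} :
    IsWeight n W ν ↔ ∃ v ∈ W, IsWeightVector ν v := by
  constructor
  · rintro ⟨v, h0, h⟩
    exact ⟨v, v.2, fun h' => h0 (Subtype.ext h'), fun k => congrArg Subtype.val (h k)⟩
  · rintro ⟨v, hv, h0, h⟩
    exact ⟨⟨v, hv⟩, fun h' => h0 (congrArg Subtype.val h'), fun k => Subtype.ext (h k)⟩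

variable [FiniteDimensional ℂ M]

/-- The operators `-√-1 e_{2k-1,2k}` commute and are symmetric, so they are jointly diagonalizable
on any invariant subspace, with real eigenvalues. -/
theorem exists_isWeightVector (hM : IsUnitaryRep n M) {E : Submodule ℂ M} (hE : E ≠ ⊥)
    (h : ∀ k, ∀ v ∈ E, cartan n M k v ∈ E) :
    ∃ ν : Fin (n / 2) → ℝ, ∃ v ∈ E, IsWeightVector ν v := by
  have htop := LinearMap.IsSymmetric.iSup_iInf_eq_top_of_commute
    (T := fun k => (cartan n M k).restrict (h k))
    (fun k => (cartan_isSymmetric hM k).restrict_invariant (h k)) fun k l _ =>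
      LinearMap.ext fun v => Subtype.ext (LinearMap.congr_fun (commute_cartan k l).eq v.1)
  have hnt : Nontrivial E := Submodule.nontrivial_iff_ne_bot.2 hE
  obtain ⟨χ, hχ⟩ : ∃ χ : Fin (n / 2) → ℂ,
      (⨅ k, Module.End.eigenspace ((cartan n M k).restrict (h k)) (χ k)) ≠ ⊥ := by
    by_contra! hbot
    rw [iSup_congr hbot, iSup_bot] at htop
    exact bot_ne_top htop
  obtain ⟨v, hv, hv0⟩ := Submodule.exists_mem_ne_zero_of_ne_bot hχ
  have hv' : ∀ k, cartan n M k v = χ k • (v : M) := fun k =>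
    congrArg Subtype.val (Module.End.mem_eigenspace_iff.1 ((Submodule.mem_iInf _).1 hv k))
  have hv1 : (v : M) ≠ 0 := fun h' => hv0 (Subtype.ext h')
  refine ⟨fun k => (χ k).re, v, v.2, hv1, fun k => ?_⟩
  rw [hv']
  congr 1
  have := cartan_isSymmetric hM k v v
  rw [hv', inner_smul_left, inner_smul_right] at this
  exact (Complex.conj_eq_iff_re.1 (mul_right_cancel₀ (inner_self_ne_zero.2 hv1) this)).symm

variable (n M) in
theorem finite_isWeight : {ν | IsWeight n M ν}.Finite := by
  have hfin : ∀ k, {x : ℝ | (cartan n M k).HasEigenvalue (x : ℂ)}.Finite := fun k =>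
    Set.Finite.preimage (Complex.ofReal_injective.injOn) (cartan n M k).finite_hasEigenvalue
  refine (Set.Finite.pi' hfin).subset ?_
  rintro ν ⟨v, hv, hw⟩ k
  exact Module.End.hasEigenvalue_of_hasEigenvector (x := v)
    ⟨Module.End.mem_eigenspace_iff.2 (hw k), hv⟩

theorem exists_isHighestWeight (hM : IsUnitaryRep n M) {W : LieSubmodule ℂ (SO n) M}
    (hW : W ≠ ⊥) : ∃ ν, IsHighestWeight n W ν := by
  have hne : {ν | IsWeight n W ν}.Nonempty := by
    obtain ⟨ν, v, hv, h⟩ := exists_isWeightVector hM (E := W.toSubmodule)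
      (by simpa using hW) fun k v hv => W.smul_mem _ (gen_mem W _ _ hv)
    exact ⟨ν, isWeight_lieSubmodule_iff.2 ⟨v, hv, h⟩⟩
  have hfin : {ν | IsWeight n W ν}.Finite :=
    (finite_isWeight n M).subset fun ν h => by
      obtain ⟨v, -, hv⟩ := isWeight_lieSubmodule_iff.1 h
      exact ⟨v, hv⟩
  obtain ⟨ν, hν, hmax⟩ := Set.exists_max_image _ toLex hfin hne
  exact ⟨ν, hν, hmax⟩

/-- Orthogonal projection to `W'` is equivariant and, by irreducibility, injective on `W` unless `W
⟂ W'`. It therefore carries a vector of weight `lam` to one in `W'`. -/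
theorem isHighestWeight_le_of_not_orthogonal (hM : IsUnitaryRep n M)
    {W W' : LieSubmodule ℂ (SO n) M} (hW : LieModule.IsIrreducible ℂ (SO n) W)
    {lam lam' : Fin (n / 2) → ℝ} (hl : IsHighestWeight n W lam) (hl' : IsHighestWeight n W' lam')
    (h : ¬ W ≤ orthLie hM W') : toLex lam ≤ toLex lam' := by
  obtain ⟨v, hvW, hv⟩ := isWeight_lieSubmodule_iff.1 hl.1
  have hvo : v ∉ orthLie hM W' := fun hvo => by
    refine h (inf_eq_left.1 (eq_of_le_irreducible hW inf_le_left fun h0 => hv.1 ?_))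
    rw [← LieSubmodule.mem_bot (R := ℂ) (L := SO n), ← h0]
    exact ⟨hvW, hvo⟩
  obtain ⟨y, hy, z, hz, hyz⟩ := W'.toSubmodule.exists_add_mem_mem_orthogonal v
  -- The defect of the eigenvalue equation for `y` is minus that for `z`, so it lies both in `W'`
  -- and in its orthogonal complement.
  have hk : ∀ k, cartan n M k y = (lam k : ℂ) • y := by
    intro k
    have h1 := hv.2 k
    rw [hyz, map_add, smul_add, ← sub_eq_sub_iff_add_eq_add] at h1
    have h2 : cartan n M k y - (lam k : ℂ) • y ∈ W' ⊓ orthLie hM W' := by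
      refine ⟨W'.sub_mem (W'.smul_mem _ (gen_mem W' _ _ hy)) (W'.smul_mem _ hy), ?_⟩
      have h3 : cartan n M k y - (lam k : ℂ) • y = (lam k : ℂ) • z - cartan n M k z := by
        rw [sub_eq_sub_iff_add_eq_add, add_comm _ ((lam k : ℂ) • y)]
        rw [sub_eq_sub_iff_add_eq_add] at h1
        exact h1
      rw [h3]
      exact (orthLie hM W').sub_mem ((orthLie hM W').smul_mem _ hz)
        ((orthLie hM W').smul_mem _ (gen_mem (orthLie hM W') _ _ hz))
    rw [inf_orthLie, LieSubmodule.mem_bot] at h2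
    exact sub_eq_zero.1 h2
  have hy0 : y ≠ 0 := by
    rintro rfl
    rw [zero_add] at hyz
    exact hvo (hyz ▸ hz)
  exact hl'.2 lam (isWeight_lieSubmodule_iff.2 ⟨y, hy, hy0, hk⟩)

theorem component_le_orthLie (hM : IsUnitaryRep n M) {lam lam' : Fin (n / 2) → ℝ}
    (h : lam ≠ lam') : component n M lam ≤ orthLie hM (component n M lam') := by
  refine sSup_le fun W hW => le_orthLie_comm.1 (sSup_le fun W' hW' => le_orthLie_comm.1 ?_)
  by_contra hno
  refine h (toLex.injective (le_antisymm
    (isHighestWeight_le_of_not_orthogonal hM hW.1 hW.2 hW'.2 hno)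
    (isHighestWeight_le_of_not_orthogonal hM hW'.1 hW'.2 hW.2 fun h' => hno ?_)))
  exact le_orthLie_comm.1 h'

/-- A nonzero orthogonal complement of the sum of all components would contain an irreducible
submodule, which has a highest weight and so already lies in a component. -/
theorem sum_starProjection_component (hM : IsUnitaryRep n M) (x : M) :
    ∑ lam ∈ constituents n M, (component n M lam).toSubmodule.starProjection x = x := by
  have hfam : OrthogonalFamily ℂ (fun i : constituents n M => (component n M i.1).toSubmodule)
      fun i => (component n M i.1).toSubmodule.subtypeₗᵢ := by
    refine OrthogonalFamily.of_pairwise fun i j hij v hv w hw => ?_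
    exact component_le_orthLie hM (fun h => hij (Subtype.ext h)) hv w hw
  rw [← Finset.sum_coe_sort]
  refine hfam.sum_projection_of_mem_iSup x ?_
  rw [← LieSubmodule.iSup_toSubmodule]
  set K := ⨆ i : constituents n M, component n M i.1 with hK
  have hbot : orthLie hM K = ⊥ := by
    by_contra hne
    obtain ⟨W, hW, hirr⟩ := exists_irreducible_le hne
    obtain ⟨ν, hν⟩ := exists_isHighestWeight hM (ne_bot_of_isIrreducible hirr)
    have hmem : ν ∈ constituents n M := (Set.Finite.mem_toFinset _).2 ⟨W, hirr, hν⟩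
    have hle : W ≤ K :=
      (le_sSup (show W ∈ {W | _ ∧ _} from ⟨hirr, hν⟩) : W ≤ component n M ν).trans
        (le_iSup (fun i : constituents n M => component n M i.1) ⟨ν, hmem⟩)
    refine ne_bot_of_isIrreducible hirr (eq_bot_iff.2 ?_)
    rw [← inf_orthLie hM K]
    exact le_inf hle hW
  have htop : K.toSubmodule = ⊤ := by
    rw [← Submodule.orthogonal_eq_bot_iff]
    exact congrArg LieSubmodule.toSubmodule hbot
  rw [htop]
  exact Submodule.mem_top

end Unitary

/-! ### Symmetrized products of Clifford homomorphisms -/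

theorem inner_op_tmul {n : ℕ} {V : Type*} [NormedAddCommGroup V] [InnerProductSpace ℂ V]
    (A : Matrix (Fin n) (Fin n) (Module.End ℂ V))
    (ξ η : EuclideanSpace ℝ (Fin n)) (ψ φ : V) :
    inner ℂ (ψ ⊗ₜ[ℂ] toCn ξ) (op V n A (φ ⊗ₜ[ℂ] toCn η)) =
      ∑ k, ∑ l, ((ξ k * η l : ℝ) : ℂ) * inner ℂ ψ (A k l φ) := by
  simp only [op_tmul, inner_sum, TensorProduct.inner_tmul, inner_smul_right,
    EuclideanSpace.inner_single_right]
  refine Finset.sum_congr rfl fun k _ => Finset.sum_congr rfl fun l _ => ?_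
  simp [toCn]
  ring

section Clifford

variable {n : ℕ} {V : Type*} [NormedAddCommGroup V] [InnerProductSpace ℂ V]
  [FiniteDimensional ℂ V] [LieRingModule (SO n) V] [LieModule ℂ (SO n) V]

theorem inner_pStar_p (lam : Fin (n / 2) → ℝ) (ξ η : Cn n) (ψ φ : V) :
    inner ℂ ψ (pStar V lam ξ (p V lam η φ)) =
      inner ℂ (ψ ⊗ₜ[ℂ] ξ) ((Comp V lam).starProjection (φ ⊗ₜ[ℂ] η)) := by
  rw [pStar, LinearMap.adjoint_inner_right]
  exact (Comp V lam).inner_orthogonalProjectionOnto_eq_of_mem_right _ _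

/-- The bridge from Clifford homomorphisms to matrices: resolve `φ ⊗ η` into its components and let
`op A` act on each by its scalar. -/
theorem sum_smul_symmProd (hV : IsUnitaryRep n V) {A : Matrix (Fin n) (Fin n) (Module.End ℂ V)}
    {f : (Fin (n / 2) → ℝ) → ℂ} (hA : ∀ lam ∈ constituents n (V ⊗[ℂ] Cn n),
      ∀ x ∈ component n (V ⊗[ℂ] Cn n) lam, op V n A x = f lam • x)
    (ξ η : EuclideanSpace ℝ (Fin n)) :
    ∑ lam ∈ constituents n (V ⊗[ℂ] Cn n), f lam • symmProd V lam ξ η =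
      ∑ k, ∑ l, ((ξ k * η l : ℝ) : ℂ) • (A + A.transpose) k l := by
  have hM : IsUnitaryRep n (V ⊗[ℂ] Cn n) := hV.tensor (isUnitaryRep_natural n)
  have key : ∀ (ξ η : EuclideanSpace ℝ (Fin n)) (ψ φ : V),
      ∑ lam ∈ constituents n (V ⊗[ℂ] Cn n), f lam *
        inner ℂ ψ (pStar V lam (toCn ξ) (p V lam (toCn η) φ)) =
          ∑ k, ∑ l, ((ξ k * η l : ℝ) : ℂ) * inner ℂ ψ (A k l φ) := by
    intro ξ η ψ φ
    rw [← inner_op_tmul]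
    conv_rhs => rw [← sum_starProjection_component hM (φ ⊗ₜ[ℂ] toCn η), map_sum, inner_sum]
    refine Finset.sum_congr rfl fun lam hlam => ?_
    rw [hA lam hlam _ (Submodule.starProjection_apply_mem _ _), inner_pStar_p]
    exact (inner_smul_right (𝕜 := ℂ) (E := V ⊗[ℂ] Cn n) _ _ _).symm
  refine LinearMap.ext fun φ => ext_inner_left ℂ fun ψ => ?_
  simp only [LinearMap.sum_apply, LinearMap.smul_apply, symmProd, LinearMap.add_apply,
    LinearMap.comp_apply, inner_sum, inner_smul_right, inner_add_right, mul_add,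
    Finset.sum_add_distrib, key, Matrix.add_apply, Matrix.transpose_apply]
  congr 1
  -- Exchanging `ξ` and `η` exchanges the summation indices, which produces the transpose.
  rw [Finset.sum_comm]
  simp only [mul_comm (η _)]

theorem sum_smul_symmProd_of_scalar (hV : IsUnitaryRep n V)
    {A : Matrix (Fin n) (Fin n) (Module.End ℂ V)}
    {f : (Fin (n / 2) → ℝ) → ℂ} (hA : ∀ lam ∈ constituents n (V ⊗[ℂ] Cn n),
      ∀ x ∈ component n (V ⊗[ℂ] Cn n) lam, op V n A x = f lam • x) {s : ℂ}
    (hs : A + A.transpose = algebraMap ℂ _ s) (ξ η : EuclideanSpace ℝ (Fin n)) :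
    ∑ lam ∈ constituents n (V ⊗[ℂ] Cn n), f lam • symmProd V lam ξ η =
      (s * (inner ℝ ξ η : ℂ)) • LinearMap.id := by
  rw [sum_smul_symmProd hV hA, hs]
  simp only [Matrix.algebraMap_matrix_apply, smul_ite, smul_zero, Finset.sum_ite_eq,
    Finset.mem_univ, if_true]
  rw [PiLp.inner_apply]
  simp only [Module.algebraMap_end_eq_smul_id, smul_smul, ← Finset.sum_smul]
  congr 1
  simp [Finset.mul_sum, mul_comm]

end Clifford

/-! ### Operators commuting with an irreducible representation -/

section Schur

variable {n : ℕ} {M : Type*} [AddCommGroup M] [Module ℂ M] [LieRingModule (SO n) M]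
  [LieModule ℂ (SO n) M]

/-- The eigenspace of an operator commuting with the representation. -/
def eigenLie {T : Module.End ℂ M} (hT : ∀ i j, Commute (gen n M i j) T) (c : ℂ) :
    LieSubmodule ℂ (SO n) M :=
  submoduleOfGen (T.eigenspace c) fun i j v hv => by
    rw [Module.End.mem_eigenspace_iff] at hv ⊢
    have h := LinearMap.congr_fun (hT i j).eq v
    simp only [Module.End.mul_apply] at h
    rw [← h, hv, map_smul]

theorem mem_eigenLie {T : Module.End ℂ M} {hT : ∀ i j, Commute (gen n M i j) T} {c : ℂ} {v : M} :
    v ∈ eigenLie hT c ↔ T v = c • v :=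
  Module.End.mem_eigenspace_iff

/-- The eigenspace is a submodule, so it contains an irreducible submodule as soon as it meets it
nontrivially. -/
theorem le_eigenLie {T : Module.End ℂ M} (hT : ∀ i j, Commute (gen n M i j) T)
    {W : LieSubmodule ℂ (SO n) M} (hW : LieModule.IsIrreducible ℂ (SO n) W) {c : ℂ} {v : M}
    (hv : v ∈ W) (hv0 : v ≠ 0) (hTv : T v = c • v) : W ≤ eigenLie hT c := by
  refine inf_eq_left.1 (eq_of_le_irreducible hW inf_le_left fun h0 => hv0 ?_)
  rw [← LieSubmodule.mem_bot (R := ℂ) (L := SO n), ← h0]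
  exact ⟨hv, mem_eigenLie.2 hTv⟩

theorem exists_le_eigenLie [FiniteDimensional ℂ M] {T : Module.End ℂ M}
    (hT : ∀ i j, Commute (gen n M i j) T)
    {W : LieSubmodule ℂ (SO n) M} (hW : LieModule.IsIrreducible ℂ (SO n) W)
    (hTW : ∀ v ∈ W, T v ∈ W) : ∃ c, W ≤ eigenLie hT c := by
  have : Nontrivial W := LieModule.nontrivial_of_isIrreducible ℂ (SO n) W
  obtain ⟨c, hc⟩ := Module.End.exists_eigenvalue (LinearMap.restrict T hTW :
    W.toSubmodule →ₗ[ℂ] W.toSubmodule)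
  obtain ⟨v, hv, hv0⟩ := hc.exists_hasEigenvector
  exact ⟨c, le_eigenLie hT hW v.2 (fun h => hv0 (Subtype.ext h))
    (congrArg Subtype.val (Module.End.mem_eigenspace_iff.1 hv))⟩

theorem exists_eq_algebraMap [FiniteDimensional ℂ M] (hM : LieModule.IsIrreducible ℂ (SO n) M)
    {T : Module.End ℂ M} (hT : ∀ i j, Commute (gen n M i j) T) :
    ∃ c, T = algebraMap ℂ _ c := by
  have : Nontrivial M := LieModule.nontrivial_of_isIrreducible ℂ (SO n) M
  obtain ⟨c, hc⟩ := T.exists_eigenvalue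
  obtain ⟨v, hv, hv0⟩ := hc.exists_hasEigenvector
  have htop : eigenLie hT c = ⊤ := (hM.eq_bot_or_eq_top _).resolve_left fun h => hv0 <| by
    rw [← LieSubmodule.mem_bot (R := ℂ) (L := SO n), ← h]
    exact hv
  refine ⟨c, LinearMap.ext fun w => ?_⟩
  exact mem_eigenLie.1 (htop ▸ LieSubmodule.mem_top w : w ∈ eigenLie hT c)

theorem act_mem (W : LieSubmodule ℂ (SO n) M) (z : U n) {v : M} (hv : v ∈ W) :
    act n M z v ∈ W := by
  have := coe_act W z ⟨v, hv⟩
  rw [← this]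
  exact Subtype.coe_prop _

end Schur

/-! ### Highest weight vectors -/

section HighestWeight

variable {n : ℕ} {M : Type*} [NormedAddCommGroup M] [InnerProductSpace ℂ M]
  [LieRingModule (SO n) M] [LieModule ℂ (SO n) M]

variable (n) in
/-- The root vector combination raising the `k`-th coordinate of weights. -/
def raising (k : Fin (n / 2)) (j : Fin n) : SO n :=
  e n (idxOdd k) j - Complex.I • e n (idxEven k) j

variable (n) in
/-- The root vector combination lowering the `k`-th coordinate of weights. -/
def lowering (k : Fin (n / 2)) (j : Fin n) : SO n :=
  e n (idxOdd k) j + Complex.I • e n (idxEven k) j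

variable (n M) in
/-- The space of vectors of a given weight killed by all raising operators. -/
def highestSpace (lam : Fin (n / 2) → ℝ) : Submodule ℂ M where
  carrier := {v | (∀ k, cartan n M k v = (lam k : ℂ) • v) ∧
    ∀ (k : Fin (n / 2)) (j : Fin n), idxEven k < j → ⁅raising n k j, v⁆ = 0}
  add_mem' {v w} hv hw := ⟨fun k => by rw [map_add, hv.1, hw.1, smul_add],
    fun k j h => by rw [lie_add, hv.2 k j h, hw.2 k j h, add_zero]⟩
  zero_mem' := ⟨fun k => by simp, fun k j _ => lie_zero _⟩
  smul_mem' c v hv := ⟨fun k => by rw [map_smul, hv.1, smul_comm],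
    fun k j h => by rw [lie_smul, hv.2 k j h, smul_zero]⟩

/-- Only `l ≤ k` is possible: `j` may lie in a later plane, where the raising operator mixes several
roots. -/
theorem cartan_raising (l k : Fin (n / 2)) (j : Fin n) (hlk : l ≤ k) (hj : idxEven k < j) (v : M) :
    cartan n M l ⁅raising n k j, v⁆ =
      ⁅raising n k j, cartan n M l v⁆ + (if l = k then (1 : ℂ) else 0) • ⁅raising n k j, v⁆ := by
  have hb : ∀ a b c d : Fin n, ⁅e n a b, ⁅e n c d, v⁆⁆ = ⁅e n c d, ⁅e n a b, v⁆⁆ +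
      ⁅⁅e n a b, e n c d⁆, v⁆ := fun a b c d => by rw [leibniz_lie, add_comm]
  have hlj : idxOdd l ≠ j ∧ idxEven l ≠ j := by
    constructor <;> rintro rfl <;>
      simp only [idxOdd, idxEven, Fin.lt_def, Fin.le_def] at hj hlk <;> omega
  simp only [cartan, raising, LinearMap.smul_apply, gen_apply, sub_lie, smul_lie, lie_sub, lie_smul,
    hb (idxOdd l) (idxEven l), e_bracket]
  rcases eq_or_ne l k with rfl | hne
  · simp [hlj.1, hlj.2, idxOdd_ne_idxEven, (idxOdd_ne_idxEven _ _).symm, smul_smul, smul_sub]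
    abel
  · simp [hlj.1, hlj.2, idxOdd_ne_idxEven, (idxOdd_ne_idxEven _ _).symm,
      idxOdd_injective.ne hne, idxEven_injective.ne hne, hne, smul_sub]

theorem mem_highestSpace_of_isHighestWeight [FiniteDimensional ℂ M] (hM : IsUnitaryRep n M)
    {W : LieSubmodule ℂ (SO n) M} {lam : Fin (n / 2) → ℝ}
    (hmax : ∀ ν, ∀ w ∈ W, IsWeightVector ν w → toLex ν ≤ toLex lam) {v : M} (hv : v ∈ W)
    (hvl : IsWeightVector lam v) : v ∈ highestSpace n M lam := by
  refine ⟨hvl.2, fun k j hj => ?_⟩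
  by_contra hne
  -- The raised vector need not be a weight vector, but its first `k` coordinates are known. They
  -- define a Cartan-stable subspace, any weight of which exceeds `lam` lexicographically.
  let F : Submodule ℂ M := W.toSubmodule ⊓ ⨅ l, ⨅ _ : l ≤ k,
    (cartan n M l).eigenspace ((lam l : ℂ) + if l = k then 1 else 0)
  have hF : ∀ w, w ∈ F ↔ w ∈ W ∧ ∀ l ≤ k,
      cartan n M l w = ((lam l : ℂ) + if l = k then 1 else 0) • w := fun w => by
    simp only [F, Submodule.mem_inf, Submodule.mem_iInf, Module.End.mem_eigenspace_iff,
      LieSubmodule.mem_toSubmodule]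
  have hmem : ⁅raising n k j, v⁆ ∈ F := by
    refine (hF _).2 ⟨W.lie_mem hv, fun l hl => ?_⟩
    rw [cartan_raising l k j hl hj, hvl.2, lie_smul, add_smul]
  obtain ⟨ν, w, hw, hνw⟩ := exists_isWeightVector hM
    (E := F) (fun h => hne (by rwa [h, Submodule.mem_bot] at hmem)) fun m w hw => by
      rw [hF] at hw ⊢
      refine ⟨W.smul_mem _ (gen_mem W _ _ hw.1), fun l hl => ?_⟩
      have := LinearMap.congr_fun (commute_cartan (M := M) l m).eq w
      simp only [Module.End.mul_apply] at this
      rw [this, hw.2 l hl, map_smul]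
  rw [hF] at hw
  have hν : ∀ l ≤ k, ν l = lam l + if l = k then 1 else 0 := fun l hl => by
    have h1 := smul_left_injective ℂ hνw.1 ((hνw.2 l).symm.trans (hw.2 l hl))
    have h2 : ((if l = k then 1 else 0 : ℝ) : ℂ) = if l = k then 1 else 0 := by
      split_ifs <;> simp
    rw [← h2] at h1
    exact_mod_cast h1
  refine absurd (hmax ν w hw.1 hνw) (not_le_of_gt ?_)
  refine ⟨k, fun l hl => ?_, ?_⟩
  · have := hν l (le_of_lt hl)
    rw [if_neg (ne_of_lt hl), add_zero] at this
    exact this.symm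
  · have := hν k le_rfl
    rw [if_pos rfl] at this
    change lam k < ν k
    rw [this]
    exact lt_add_one _

theorem exists_mem_highestSpace [FiniteDimensional ℂ M] (hM : IsUnitaryRep n M)
    {W : LieSubmodule ℂ (SO n) M} {lam : Fin (n / 2) → ℝ} (h : IsHighestWeight n W lam) :
    ∃ v ∈ W, v ≠ 0 ∧ v ∈ highestSpace n M lam := by
  obtain ⟨v, hv, hvl⟩ := isWeight_lieSubmodule_iff.1 h.1
  exact ⟨v, hv, hvl.1, mem_highestSpace_of_isHighestWeight hM
    (fun ν w hw hνw => h.2 ν (isWeight_lieSubmodule_iff.2 ⟨w, hw, hνw⟩)) hv hvl⟩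

theorem exists_mem_highestSpace_self [FiniteDimensional ℂ M] (hM : IsUnitaryRep n M)
    {lam : Fin (n / 2) → ℝ} (h : IsHighestWeight n M lam) :
    ∃ v : M, v ≠ 0 ∧ v ∈ highestSpace n M lam := by
  obtain ⟨v, hv⟩ := isWeight_iff.1 h.1
  exact ⟨v, hv.1, mem_highestSpace_of_isHighestWeight hM (W := ⊤)
    (fun ν w _ hνw => h.2 ν ⟨w, hνw⟩) (LieSubmodule.mem_top v) hv⟩

theorem gen_of_mem_highestSpace {lam : Fin (n / 2) → ℝ} {v : M}
    (hv : v ∈ highestSpace n M lam) (k : Fin (n / 2)) :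
    gen n M (idxOdd k) (idxEven k) v = (Complex.I * lam k) • v := by
  have := hv.1 k
  rw [cartan, LinearMap.smul_apply] at this
  rw [mul_smul, ← this, smul_smul]
  simp

theorem gen_odd_of_mem_highestSpace {lam : Fin (n / 2) → ℝ} {v : M}
    (hv : v ∈ highestSpace n M lam) {k : Fin (n / 2)} {j : Fin n} (hj : idxEven k < j) :
    gen n M (idxOdd k) j v = Complex.I • gen n M (idxEven k) j v := by
  have := hv.2 k j hj
  rw [raising, sub_lie, smul_lie, sub_eq_zero] at this
  exact this

/-! ### The quadratic Casimir element -/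

variable (n M) in
/-- The sum of the squares of all `e_{ij}`. -/
def squareSum : Module.End ℂ M :=
  ∑ i, ∑ j, gen n M i j * gen n M i j

theorem commute_squareSum (i j : Fin n) : Commute (gen n M i j) (squareSum n M) := by
  have h : squareSum n M = -(Matrix.of (gen n M) ^ 2).trace := by
    simp only [squareSum, Matrix.trace, Matrix.diag_apply, pow_two, Matrix.mul_apply,
      Matrix.of_apply, ← Finset.sum_neg_distrib]
    refine Finset.sum_congr rfl fun i _ => Finset.sum_congr rfl fun j _ => ?_
    rw [soRel_gen.skew i j, mul_neg, neg_neg]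
  rw [h]
  exact (commute_trace ((soRel_gen.commute_tensorGen i j).pow_right 2)).neg_right

/-- This count of the indices beyond the `k`-th plane is where `δ` enters the Casimir value. -/
theorem card_filter_idxEven_lt (k : Fin (n / 2)) :
    ((Finset.univ.filter fun j : Fin n => idxEven k < j).card : ℝ) = 2 * delta n k := by
  have h : (Finset.univ.filter fun j : Fin n => idxEven k < j) = Finset.Ioi (idxEven k) := by
    ext j
    simp
  rw [h, Fin.card_Ioi, delta]
  have := k.2
  simp only [idxEven]
  rw [Nat.sub_sub, Nat.cast_sub (by omega)]
  push_cast
  ring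

/-- The value of the Casimir element on a representation of highest weight `lam`. -/
def casimirValue (lam : Fin (n / 2) → ℝ) : ℝ :=
  ∑ k, (lam k ^ 2 + 2 * delta n k * lam k)

/-- The plane itself contributes `-lam k ^ 2`. For each later `j`, the highest weight condition
turns `e_{2k-1,j}² + e_{2k,j}²` into `√-1 [e_{2k-1,j}, e_{2k,j}] = √-1 e_{2k-1,2k}`, contributing
`-lam k`. The outer factor 2 counts ordered pairs. -/
theorem squareSum_of_mem_highestSpace {lam : Fin (n / 2) → ℝ} {v : M}
    (hv : v ∈ highestSpace n M lam) :
    squareSum n M v = (-2 * casimirValue lam : ℂ) • v := by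
  set f : Fin n → Fin n → M := fun i j => gen n M i j (gen n M i j v) with hf
  have hsymm : ∀ i j, f j i = f i j := fun i j => by
    simp [hf, soRel_gen.skew (x := gen n M) i j]
  have hdiag : ∀ i, f i i = 0 := fun i => by
    simp [hf, soRel_gen.self_eq_zero (x := gen n M) i]
  have h1 : squareSum n M v = (2 : ℂ) • ∑ i, ∑ j, if i < j then f i j else 0 := by
    have h2 : squareSum n M v = ∑ i, ∑ j, f i j := by
      simp [squareSum, hf, LinearMap.sum_apply]
    have h3 : ∀ i j, f i j = (if i < j then f i j else 0) + if j < i then f j i else 0 := by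
      intro i j
      rcases lt_trichotomy i j with h | rfl | h
      · simp [h, h.le]
      · simp [hdiag]
      · simp [h, h.le, hsymm]
    rw [h2, two_smul]
    conv_lhs => enter [2, i, 2, j]; rw [h3]
    simp only [Finset.sum_add_distrib]
    congr 1
    exact Finset.sum_comm
  have h4 : ∀ k : Fin (n / 2), (∑ j, if idxOdd k < j then f (idxOdd k) j else 0) +
      (∑ j, if idxEven k < j then f (idxEven k) j else 0) =
        (-(lam k ^ 2 + 2 * delta n k * lam k : ℝ) : ℂ) • v := by
    intro k
    have h5 : ∀ j, (if idxOdd k < j then f (idxOdd k) j else 0) =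
        (if j = idxEven k then f (idxOdd k) (idxEven k) else 0) +
          if idxEven k < j then f (idxOdd k) j else 0 := by
      intro j
      rcases eq_or_ne j (idxEven k) with rfl | hne
      · have : idxOdd k < idxEven k := by simp [idxOdd, idxEven, Fin.lt_def]
        simp [this]
      · have : idxOdd k < j ↔ idxEven k < j := by
          rw [ne_eq, Fin.ext_iff] at hne
          simp only [idxOdd, idxEven, Fin.lt_def] at hne ⊢
          omega
        simp [this, hne]
    have h6 : ∀ j, (if idxEven k < j then f (idxOdd k) j else 0) +
        (if idxEven k < j then f (idxEven k) j else 0) =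
          if idxEven k < j then (-lam k : ℂ) • v else 0 := by
      intro j
      split_ifs with hj
      · have h7 := LinearMap.congr_fun
          (soRel_gen.bracket (x := gen n M) (idxOdd k) j (idxEven k) j) v
        have h8 : idxOdd k ≠ j := by
          rintro rfl
          simp [idxOdd, idxEven, Fin.lt_def] at hj
        simp only [idxOdd_ne_idxEven, hj.ne', h8, if_false, if_true, sub_zero, zero_sub, add_zero,
          soRel_gen.skew (x := gen n M) (idxOdd k) (idxEven k), neg_neg, LinearMap.sub_apply,
          Module.End.mul_apply, gen_of_mem_highestSpace hv] at h7
        have h9 : gen n M (idxEven k) j v = -(Complex.I • gen n M (idxOdd k) j v) := by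
          rw [gen_odd_of_mem_highestSpace hv hj, smul_smul]
          simp
        have h10 : f (idxOdd k) j = Complex.I •
            gen n M (idxOdd k) j (gen n M (idxEven k) j v) := by
          simp only [hf]
          rw [← map_smul, ← gen_odd_of_mem_highestSpace hv hj]
        have h11 : f (idxEven k) j = -(Complex.I •
            gen n M (idxEven k) j (gen n M (idxOdd k) j v)) := by
          simp only [hf]
          rw [← map_smul, ← map_neg, ← h9]
        rw [h10, h11, ← sub_eq_add_neg, ← smul_sub, h7, smul_smul, ← mul_assoc]
        simp
      · simp
    simp only [h5, Finset.sum_add_distrib]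
    rw [Finset.sum_ite_eq' Finset.univ, if_pos (Finset.mem_univ _), add_assoc, ← Finset.sum_add_distrib]
    simp only [h6]
    rw [← Finset.sum_filter, Finset.sum_const]
    simp only [hf, gen_of_mem_highestSpace hv, map_smul, smul_smul]
    rw [← Nat.cast_smul_eq_nsmul ℂ, smul_smul, ← add_smul]
    congr 1
    have h12 := congrArg (fun x : ℝ => (x : ℂ)) (card_filter_idxEven_lt (n := n) k)
    simp only [Complex.ofReal_natCast] at h12
    rw [h12]
    push_cast
    linear_combination (lam k : ℂ) ^ 2 * Complex.I_mul_I
  rw [h1, sum_fin_pairs]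
  · simp only [h4, ← Finset.sum_smul, smul_smul, casimirValue]
    congr 1
    push_cast
    rw [Finset.sum_neg_distrib]
    ring
  · intro i hi
    refine Finset.sum_eq_zero fun j _ => if_neg ?_
    rw [Fin.lt_def]
    omega

/-! ### Uniqueness of the representation of a given highest weight -/

theorem gen_mem_of_raising_mem {E : Submodule ℂ M} {y : M}
    (hc : ∀ k : Fin (n / 2), ⁅e n (idxOdd k) (idxEven k), y⁆ ∈ E)
    (hl : ∀ (k : Fin (n / 2)) (j : Fin n), idxEven k < j → ⁅lowering n k j, y⁆ ∈ E)
    (hr : ∀ (k : Fin (n / 2)) (j : Fin n), idxEven k < j → ⁅raising n k j, y⁆ ∈ E) (i j : Fin n) :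
    gen n M i j y ∈ E := by
  have hlt : ∀ i j : Fin n, i < j → gen n M i j y ∈ E := by
    intro i j hij
    have hk : (i : ℕ) / 2 < n / 2 := by
      have := j.2
      rw [Fin.lt_def] at hij
      omega
    set k : Fin (n / 2) := ⟨(i : ℕ) / 2, hk⟩ with hkdef
    have ho : idxEven k < j → ⁅e n (idxOdd k) j, y⁆ ∈ E := fun hj => by
      have h : e n (idxOdd k) j = (1 / 2 : ℂ) • (lowering n k j + raising n k j) := by
        simp only [lowering, raising, add_add_sub_cancel, ← two_smul ℂ, smul_smul]
        norm_num
      rw [h, smul_lie, add_lie]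
      exact E.smul_mem _ (E.add_mem (hl k j hj) (hr k j hj))
    have he : idxEven k < j → ⁅e n (idxEven k) j, y⁆ ∈ E := fun hj => by
      have h : e n (idxEven k) j = (-Complex.I / 2) • (lowering n k j - raising n k j) := by
        simp only [lowering, raising, add_sub_sub_cancel, ← two_smul ℂ, smul_smul]
        rw [show -Complex.I / 2 * (2 * Complex.I) = 1 by
          linear_combination -Complex.I_mul_I, one_smul]
      rw [h, smul_lie, sub_lie]
      exact E.smul_mem _ (E.sub_mem (hl k j hj) (hr k j hj))
    rw [gen_apply]
    rcases Nat.even_or_odd' (i : ℕ) with ⟨c, hc' | hc'⟩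
    · have hi : i = idxOdd k := Fin.ext (by simp only [idxOdd, hkdef]; omega)
      rcases eq_or_ne j (idxEven k) with hj | hj
      · rw [hi, hj]
        exact hc k
      · rw [hi]
        refine ho ?_
        rw [ne_eq, Fin.ext_iff] at hj
        simp only [idxEven, hkdef, Fin.lt_def] at hj hij ⊢
        omega
    · have hi : i = idxEven k := Fin.ext (by simp only [idxEven, hkdef]; omega)
      rw [hi] at hij ⊢
      exact he hij
  rcases lt_trichotomy i j with h | rfl | h
  · exact hlt i j h
  · rw [soRel_gen.self_eq_zero (x := gen n M)]
    exact E.zero_mem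
  · rw [soRel_gen.skew (x := gen n M) j i]
    exact E.neg_mem (hlt j i h)

/-- The vectors obtained from `x` by operators of the lowering Borel subalgebra. -/
inductive Reach (x : M) : M → Prop
  | base : Reach x x
  | zero : Reach x 0
  | add {y z : M} : Reach x y → Reach x z → Reach x (y + z)
  | smul (c : ℂ) {y : M} : Reach x y → Reach x (c • y)
  | cartan (k : Fin (n / 2)) {y : M} : Reach x y → Reach x ⁅e n (idxOdd k) (idxEven k), y⁆
  | lowering (k : Fin (n / 2)) (j : Fin n) (hj : idxEven k < j) {y : M} :
      Reach x y → Reach x ⁅lowering n k j, y⁆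

variable (n) in
/-- The subspace of the vectors obtained from `x` by the lowering Borel subalgebra. -/
def reachSubmodule (x : M) : Submodule ℂ M where
  carrier := {y | Reach (n := n) x y}
  add_mem' := Reach.add
  zero_mem' := Reach.zero
  smul_mem' c _ := Reach.smul c

/-- A raising operator is moved past each step `X` by `r X y = [r, X] y + X r y`, until it reaches
`x` and kills it. So the lowering Borel subalgebra already generates a submodule from `x`. -/
theorem Reach.gen_mem {lam : Fin (n / 2) → ℝ} {x : M} (hx : x ∈ highestSpace n M lam) {y : M}
    (hy : Reach (n := n) x y) (i j : Fin n) : gen n M i j y ∈ reachSubmodule n x := by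
  have hstep : ∀ (X : SO n), (∀ z ∈ reachSubmodule n x, ⁅X, z⁆ ∈ reachSubmodule n x) →
      ∀ y, Reach (n := n) x y → (∀ i j, gen n M i j y ∈ reachSubmodule n x) →
        ∀ i j, gen n M i j ⁅X, y⁆ ∈ reachSubmodule n x := by
    intro X hX y hy hgen i j
    have hXy : Reach (n := n) x ⁅X, y⁆ := hX y hy
    refine gen_mem_of_raising_mem (fun k => hXy.cartan k) (fun k j hj => hXy.lowering k j hj)
      (fun k j _ => ?_) i j
    rw [leibniz_lie]
    exact add_mem (lie_mem_of_gen hgen _) (hX _ (lie_mem_of_gen hgen _))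
  induction hy generalizing i j with
  | base =>
    refine gen_mem_of_raising_mem (fun k => Reach.base.cartan k)
      (fun k j hj => Reach.base.lowering k j hj) (fun k j hj => ?_) i j
    rw [hx.2 k j hj]
    exact zero_mem _
  | zero =>
    rw [map_zero]
    exact zero_mem _
  | add _ _ h₁ h₂ =>
    rw [map_add]
    exact add_mem (h₁ i j) (h₂ i j)
  | smul c _ h =>
    rw [map_smul]
    exact Submodule.smul_mem _ _ (h i j)
  | cartan k hy h => exact hstep _ (fun z hz => Reach.cartan k hz) _ hy h i j
  | lowering k j' hj' hy h => exact hstep _ (fun z hz => Reach.lowering k j' hj' hz) _ hy h i j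

/-- The adjoint of a lowering operator is minus a raising operator, which kills `d`. Hence a
reachable vector projects to the highest weight space as a multiple of `x`. -/
theorem Reach.exists_inner_eq_zero (hM : IsUnitaryRep n M) {lam : Fin (n / 2) → ℝ} {x : M}
    (hx : x ∈ highestSpace n M lam) {y : M} (hy : Reach (n := n) x y) :
    ∃ c : ℂ, ∀ d ∈ highestSpace n M lam, inner ℂ d (y - c • x) = 0 := by
  induction hy with
  | base => exact ⟨1, fun d _ => by simp⟩
  | zero => exact ⟨0, fun d _ => by simp⟩
  | add _ _ h₁ h₂ =>
    obtain ⟨c₁, h₁⟩ := h₁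
    obtain ⟨c₂, h₂⟩ := h₂
    refine ⟨c₁ + c₂, fun d hd => ?_⟩
    rw [add_smul, add_sub_add_comm, inner_add_right, h₁ d hd, h₂ d hd, add_zero]
  | smul c _ h =>
    obtain ⟨a, h⟩ := h
    refine ⟨c * a, fun d hd => ?_⟩
    rw [mul_smul, ← smul_sub, inner_smul_right, h d hd, mul_zero]
  | @cartan k y _ h =>
    obtain ⟨a, h⟩ := h
    refine ⟨a * (Complex.I * lam k), fun d hd => ?_⟩
    rw [mul_smul, ← gen_of_mem_highestSpace hx, ← map_smul, ← gen_apply, ← map_sub,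
      ← neg_eq_iff_eq_neg.2 (hM.inner_gen _ _ _ _), gen_of_mem_highestSpace hd, inner_smul_left,
      h d hd, mul_zero, neg_zero]
  | @lowering k j hj y _ _ =>
    refine ⟨0, fun d hd => ?_⟩
    have h1 := hM.inner_gen (idxOdd k) j d y
    have h2 := hM.inner_gen (idxEven k) j d y
    rw [gen_odd_of_mem_highestSpace hd hj, inner_smul_left, h2] at h1
    rw [CliffordHom.lowering, zero_smul, sub_zero, add_lie, smul_lie, inner_add_right,
      inner_smul_right, ← gen_apply, ← gen_apply]
    simp only [Complex.conj_I] at h1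
    linear_combination h1

/-- If `b ≠ b'`, the submodule generated by `v + v'` contains `v'`. But its only highest weight
vectors of weight `lam` are multiples of `v + v'`, so `v' = c (v + v')`; comparing eigenvalues
forces `c = 1` and `v = 0`. -/
theorem eigenvalue_eq_of_highestSpace (hM : IsUnitaryRep n M) {lam : Fin (n / 2) → ℝ}
    {z : U n} {v v' : M} (hv : v ∈ highestSpace n M lam) (hv' : v' ∈ highestSpace n M lam)
    (hv0 : v ≠ 0) (hv0' : v' ≠ 0) {b b' : ℂ} (hb : act n M z v = b • v)
    (hb' : act n M z v' = b' • v') : b = b' := by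
  by_contra hne
  have hx : v + v' ∈ highestSpace n M lam := add_mem hv hv'
  let N : LieSubmodule ℂ (SO n) M :=
    submoduleOfGen (reachSubmodule n (v + v')) fun i j y hy => Reach.gen_mem hx hy i j
  have hxN : v + v' ∈ N := Reach.base
  have h1 : v' ∈ N := by
    have h2 : act n M z (v + v') - b • (v + v') ∈ N :=
      N.sub_mem (act_mem N z hxN) (N.smul_mem _ hxN)
    have h3 : act n M z (v + v') - b • (v + v') = (b' - b) • v' := by
      rw [map_add, hb, hb', smul_add, sub_smul]
      abel
    rw [h3] at h2
    have h4 := N.smul_mem (b' - b)⁻¹ h2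
    rwa [inv_smul_smul₀ (sub_ne_zero.2 (Ne.symm hne))] at h4
  obtain ⟨c, hc⟩ := Reach.exists_inner_eq_zero hM hx h1
  have h5 : v' = c • (v + v') :=
    sub_eq_zero.1 (inner_self_eq_zero.1 (hc _ (sub_mem hv' (Submodule.smul_mem _ c hx))))
  have h6 := congrArg (act n M z) h5
  rw [map_smul, map_add, hb, hb'] at h6
  have h7 : ((1 - c) * (b' - b)) • v' = 0 := by
    have h8 : b • v' = b • (c • (v + v')) := congrArg (b • ·) h5
    have h9 : b' • v' - b • v' = c • ((b' - b) • v') := by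
      rw [h6, h8]
      module
    have h10 : ((1 - c) * (b' - b)) • v' = (b' • v' - b • v') - c • ((b' - b) • v') := by module
    rw [h10, h9, sub_self]
  have h11 : c = 1 := by
    rcases mul_eq_zero.1 ((smul_eq_zero_iff_left hv0').1 h7) with h | h
    · exact (sub_eq_zero.1 h).symm
    · exact absurd (sub_eq_zero.1 h).symm hne
  rw [h11, one_smul, right_eq_add] at h5
  exact hv0 h5

end HighestWeight

/-! ### Operators on the components of `V ⊗ ℂⁿ` -/

section Components

variable {n : ℕ}

/-- The component is defined as a sum of possibly many irreducible submodules; their highest weight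
vectors force a common constant. -/
theorem exists_component_le_eigenLie_act {M : Type*} [NormedAddCommGroup M]
    [InnerProductSpace ℂ M] [FiniteDimensional ℂ M] [LieRingModule (SO n) M]
    [LieModule ℂ (SO n) M] (hM : IsUnitaryRep n M) {z : U n}
    (hz : ∀ i j, Commute (gen n M i j) (act n M z)) {lam : Fin (n / 2) → ℝ}
    (hlam : lam ∈ constituents n M) :
    ∃ c, component n M lam ≤ eigenLie hz c := by
  obtain ⟨W, hW, hWl⟩ := (Set.Finite.mem_toFinset _).1 hlam
  obtain ⟨c, hc⟩ := exists_le_eigenLie hz hW fun v hv => act_mem W z hv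
  refine ⟨c, sSup_le fun W' hW' => ?_⟩
  obtain ⟨c', hc'⟩ := exists_le_eigenLie hz hW'.1 fun v hv => act_mem W' z hv
  obtain ⟨v, hv, hv0, hvl⟩ := exists_mem_highestSpace hM hWl
  obtain ⟨v', hv', hv0', hvl'⟩ := exists_mem_highestSpace hM hW'.2
  rw [eigenvalue_eq_of_highestSpace hM hvl hvl' hv0 hv0' (mem_eigenLie.1 (hc hv))
    (mem_eigenLie.1 (hc' hv'))]
  exact hc'

theorem squareSum_of_mem_component {M : Type*} [NormedAddCommGroup M]
    [InnerProductSpace ℂ M] [FiniteDimensional ℂ M] [LieRingModule (SO n) M]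
    [LieModule ℂ (SO n) M] (hM : IsUnitaryRep n M) {lam : Fin (n / 2) → ℝ} {x : M}
    (hx : x ∈ component n M lam) : squareSum n M x = (-2 * casimirValue lam : ℂ) • x := by
  refine mem_eigenLie (hT := commute_squareSum).1
    ((sSup_le fun W hW => ?_ : component n M lam ≤ _) hx)
  obtain ⟨v, hv, hv0, hvl⟩ := exists_mem_highestSpace hM hW.2
  exact le_eigenLie commute_squareSum hW.1 hv hv0 (squareSum_of_mem_highestSpace hvl)

variable {V : Type*} [NormedAddCommGroup V] [InnerProductSpace ℂ V]
  [FiniteDimensional ℂ V] [LieRingModule (SO n) V] [LieModule ℂ (SO n) V]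

theorem squareSum_eq_algebraMap (hirr : LieModule.IsIrreducible ℂ (SO n) V)
    (hV : IsUnitaryRep n V) {ρ : Fin (n / 2) → ℝ} (hρ : IsHighestWeight n V ρ) :
    squareSum n V = algebraMap ℂ _ (-2 * casimirValue ρ : ℂ) := by
  obtain ⟨c, hc⟩ := exists_eq_algebraMap hirr (commute_squareSum (n := n) (M := V))
  obtain ⟨v, hv0, hv⟩ := exists_mem_highestSpace_self hV hρ
  have h := squareSum_of_mem_highestSpace hv
  rw [hc] at h ⊢
  rw [smul_left_injective ℂ hv0 h]

theorem confWeight_eq_casimirValue (ρ lam : Fin (n / 2) → ℝ) :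
    confWeight ρ lam = 1 / 2 * (casimirValue lam - casimirValue ρ - n + 1) := by
  have h : ∀ μ : Fin (n / 2) → ℝ, ∑ k, (delta n k + μ k) ^ 2 =
      ∑ k, delta n k ^ 2 + casimirValue μ := fun μ => by
    rw [casimirValue, ← Finset.sum_add_distrib]
    exact Finset.sum_congr rfl fun k _ => by ring
  rw [confWeight, h, h]
  ring

/-- Since `E` is the cross term in the Casimir operator of the tensor product, its value is read off
from the Casimir values of `lam` and `ρ`. -/
theorem op_gen_of_mem_component (hirr : LieModule.IsIrreducible ℂ (SO n) V)
    (hV : IsUnitaryRep n V) {ρ : Fin (n / 2) → ℝ} (hρ : IsHighestWeight n V ρ)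
    {lam : Fin (n / 2) → ℝ} {x : V ⊗[ℂ] Cn n} (hx : x ∈ component n (V ⊗[ℂ] Cn n) lam) :
    op V n (Matrix.of (gen n V)) x = (confWeight ρ lam : ℂ) • x := by
  have h1 := congrArg (op V n) (soRel_gen (n := n) (M := V)).sum_tensorGen_mul_self
  have h2 : Matrix.scalar (Fin n) (∑ i, ∑ j, gen n V i j * gen n V i j) =
      algebraMap ℂ _ (-2 * casimirValue ρ : ℂ) := by
    change Matrix.scalar (Fin n) (squareSum n V) = _
    rw [squareSum_eq_algebraMap hirr hV hρ]
    rfl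
  simp only [h2, map_sum, map_sub, map_mul (op V n), op_tensorGen, map_zsmul, map_one (op V n),
    AlgHom.commutes] at h1
  have h3 := LinearMap.congr_fun h1 x
  have h4 := squareSum_of_mem_component (hV.tensor (isUnitaryRep_natural n)) hx
  rw [squareSum, h3] at h4
  simp only [LinearMap.sub_apply, LinearMap.smul_apply, Module.End.one_apply,
    Module.algebraMap_end_apply, ← Int.cast_smul_eq_zsmul ℂ] at h4
  push_cast at h4
  rw [confWeight_eq_casimirValue]
  push_cast
  linear_combination (norm := module) (-(1 / 4) : ℂ) • h4

end Components

end CliffordHom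

end

/-! ### The main theorem. -/

open CliffordHom
theorem theorem4p7 (n : ℕ) (V : Type*) [NormedAddCommGroup V] [InnerProductSpace ℂ V]
    [FiniteDimensional ℂ V] [LieRingModule (SO n) V] [LieModule ℂ (SO n) V]
    (hirr : LieModule.IsIrreducible ℂ (SO n) V) (hunit : IsUnitaryRep n V)
    (ρ : Fin (n / 2) → ℝ) (hρ : IsHighestWeight n V ρ) :
    (∀ ξ η : EuclideanSpace ℝ (Fin n),
      ∑ lam ∈ constituents n (V ⊗[ℂ] Cn n), symmProd V lam ξ η =
        (2 * (inner ℝ ξ η : ℂ)) • LinearMap.id) ∧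
    (∃ c : ℕ → ℂ, (∀ q, ActsAs n V (cHat n q) (c q)) ∧
      ∀ q : ℕ, 1 ≤ q → ∀ ξ η : EuclideanSpace ℝ (Fin n),
        ∑ lam ∈ constituents n (V ⊗[ℂ] Cn n),
          (∑ r ∈ Finset.range (2 * q), (-(confWeightHat ρ lam : ℂ)) ^ r * c (2 * q - 1 - r)) •
            symmProd V lam ξ η = 0) ∧
    (Even n → ∃ (a : ℂ) (b : (Fin (n / 2) → ℝ) → ℂ), ActsAs n V (pf n) a ∧
      (∀ lam ∈ constituents n (V ⊗[ℂ] Cn n),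
        ActsAs n (component n (V ⊗[ℂ] Cn n) lam) (pf n) (b lam)) ∧
      (∀ ξ η : EuclideanSpace ℝ (Fin n),
        ∑ lam ∈ constituents n (V ⊗[ℂ] Cn n), b lam • symmProd V lam ξ η =
          (2 * a * (inner ℝ ξ η : ℂ)) • LinearMap.id) ∧
      ∀ ξ η : EuclideanSpace ℝ (Fin n),
        ∑ lam ∈ constituents n (V ⊗[ℂ] Cn n),
          (b lam * ((confWeight ρ lam : ℂ) - 1)) • symmProd V lam ξ η = 0) := by
  have hM : IsUnitaryRep n (V ⊗[ℂ] Cn n) := hunit.tensor (isUnitaryRep_natural n)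
  have hrel : SoRel (gen n V) := soRel_gen
  have hE : ∀ lam, ∀ x ∈ component n (V ⊗[ℂ] Cn n) lam,
      op V n (Matrix.of (gen n V)) x = (confWeight ρ lam : ℂ) • x :=
    fun lam x hx => op_gen_of_mem_component hirr hunit hρ hx
  refine ⟨fun ξ η => ?_, ?_, fun hn => ?_⟩
  · have h := sum_smul_symmProd_of_scalar hunit (A := 1) (f := fun _ => 1) (s := 2)
      (fun lam _ x _ => by rw [map_one, Module.End.one_apply, one_smul])
      (by rw [Matrix.transpose_one, one_add_one_eq_two, map_ofNat]) ξ η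
    simpa only [one_smul] using h
  · set A : Matrix (Fin n) (Fin n) (Module.End ℂ V) :=
      Matrix.of (gen n V) + algebraMap ℂ _ (((n : ℂ) - 1) / 2) with hA
    choose c hc using fun q => exists_eq_algebraMap hirr (T := (A ^ q).trace)
      fun i j => commute_trace (hrel.commute_eHat_pow _ i j q)
    refine ⟨c, fun q v => ?_, fun q _ ξ η => ?_⟩
    · rw [act_cHat, ← hA, hc, Module.algebraMap_end_apply]
    · have hAx : ∀ lam, ∀ x ∈ component n (V ⊗[ℂ] Cn n) lam,
          op V n (-A) x = (-(confWeightHat ρ lam : ℂ)) • x := fun lam x hx => by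
        rw [hA, map_neg, map_add, AlgHom.commutes, LinearMap.neg_apply, LinearMap.add_apply,
          hE lam x hx, Module.algebraMap_end_apply, ← add_smul, neg_smul, confWeightHat]
        push_cast
        rfl
      have hpow : ∀ lam, ∀ x ∈ component n (V ⊗[ℂ] Cn n) lam, ∀ r : ℕ,
          op V n ((-A) ^ r) x = (-(confWeightHat ρ lam : ℂ)) ^ r • x := fun lam x hx r => by
        induction r with
        | zero => simp
        | succ r ih =>
          rw [pow_succ', map_mul, Module.End.mul_apply, ih, map_smul, hAx lam x hx, smul_smul,
            pow_succ]
      have h := sum_smul_symmProd_of_scalar hunit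
        (A := ∑ r ∈ Finset.range (2 * q), c (2 * q - 1 - r) • (-A) ^ r)
        (f := fun lam => ∑ r ∈ Finset.range (2 * q),
          (-(confWeightHat ρ lam : ℂ)) ^ r * c (2 * q - 1 - r)) (s := 0)
        (fun lam _ x hx => by
          simp only [map_sum, map_smul, LinearMap.sum_apply, LinearMap.smul_apply,
            hpow lam x hx, Finset.sum_smul, smul_smul, mul_comm])
        (by rw [map_zero]; exact sum_trace_smul_eHat_pow hrel hA hc q) ξ η
      rw [h, zero_mul, zero_smul]
  · have hpfM : act n (V ⊗[ℂ] Cn n) (pf n) = op V n (pfaffian (tensorGen (gen n V))) := by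
      rw [act_pf, map_pfaffian]
      simp only [op_tensorGen]
    obtain ⟨a, ha⟩ := exists_eq_algebraMap hirr (T := pfaffian (gen n V))
      fun i j => hrel.commute_pfaffian hn i j
    have hz : ∀ i j, Commute (gen n (V ⊗[ℂ] Cn n) i j) (act n (V ⊗[ℂ] Cn n) (pf n)) :=
      fun i j => by
        rw [act_pf]
        exact soRel_gen.commute_pfaffian hn i j
    choose! b hb using fun lam (hlam : lam ∈ constituents n (V ⊗[ℂ] Cn n)) =>
      exists_component_le_eigenLie_act hM hz hlam
    have hbx : ∀ lam ∈ constituents n (V ⊗[ℂ] Cn n), ∀ x ∈ component n (V ⊗[ℂ] Cn n) lam,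
        act n (V ⊗[ℂ] Cn n) (pf n) x = b lam • x := fun lam hlam x hx =>
      mem_eigenLie.1 (hb lam hlam hx)
    have hP : pfaffian (tensorGen (gen n V)) =
        algebraMap ℂ _ a + pfaffianLinear (gen n V) := by
      rw [pfaffian_tensorGen, ha]
      rfl
    have hQ := pfaffianLinear_transpose (gen n V)
    have hPt : (pfaffian (tensorGen (gen n V))).transpose =
        algebraMap ℂ _ a - pfaffianLinear (gen n V) := by
      rw [hP, Matrix.transpose_add, hQ, Matrix.algebraMap_eq_diagonal, Matrix.diagonal_transpose,
        sub_eq_add_neg]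
    refine ⟨a, b, fun v => ?_, fun lam hlam v => ?_, fun ξ η => ?_, fun ξ η => ?_⟩
    · rw [act_pf, ha, Module.algebraMap_end_apply]
    · exact Subtype.ext ((coe_act _ _ _).trans (hbx lam hlam v v.2))
    · refine sum_smul_symmProd_of_scalar hunit (A := pfaffian (tensorGen (gen n V)))
        (fun lam hlam x hx => by rw [← hpfM, hbx lam hlam x hx]) ?_ ξ η
      rw [hPt, hP, two_mul, map_add]
      abel
    -- `P` is the difference of the Pfaffian on `V ⊗ ℂⁿ` and a scalar, both equivariant, so `PE` is
    -- equivariant with constant diagonal.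
    · have hX := add_transpose_apply_of_diag (x := gen n V)
        (T := pfaffianLinear (gen n V) * Matrix.of (gen n V)) (a := pfaffian (gen n V))
        (fun i j => by
          refine Commute.mul_right ?_ (hrel.commute_tensorGen i j)
          rw [← add_sub_cancel_left (algebraMap ℂ _ a) (pfaffianLinear (gen n V)), ← hP]
          exact (hrel.tensorGen.commute_pfaffian hn i j).sub_right (Algebra.commutes _ _).symm)
        (hrel.pfaffianLinear_mul_diag hn) (hrel.commute_pfaffian hn)
      have hs : Matrix.scalar (Fin n) (pfaffian (gen n V) + pfaffian (gen n V)) =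
          algebraMap ℂ _ a + algebraMap ℂ _ a := by
        rw [ha, map_add]
        rfl
      have hEt : (Matrix.of (gen n V)).transpose = -Matrix.of (gen n V) :=
        Matrix.ext fun i j => hrel.skew i j
      have h := sum_smul_symmProd_of_scalar hunit
        (A := pfaffian (tensorGen (gen n V)) * (Matrix.of (gen n V) - 1))
        (f := fun lam => b lam * ((confWeight ρ lam : ℂ) - 1)) (s := 0)
        (fun lam hlam x hx => by
          rw [map_mul, Module.End.mul_apply, ← hpfM, map_sub, map_one, LinearMap.sub_apply,
            hE lam x hx, Module.End.one_apply]
          rw [map_sub, map_smul, hbx lam hlam x hx]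
          module) ?_ ξ η
      · rw [h, zero_mul, zero_smul]
      · rw [hs] at hX
        -- Expanded as `aE + PE - a - P`. Adding the transpose cancels `aE` and `P`, which are skew,
        -- and `PE + (PE)ᵀ = 2a` cancels the two copies of `-a`.
        have h1 : pfaffian (tensorGen (gen n V)) * (Matrix.of (gen n V) - 1) =
            a • Matrix.of (gen n V) + pfaffianLinear (gen n V) * Matrix.of (gen n V) -
              algebraMap ℂ _ a - pfaffianLinear (gen n V) := by
          rw [hP, mul_sub, mul_one, add_mul, ← Algebra.smul_def]
          abel
        have h2 : (algebraMap ℂ (Matrix (Fin n) (Fin n) (Module.End ℂ V)) a).transpose =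
            algebraMap ℂ _ a := by
          rw [Matrix.algebraMap_eq_diagonal, Matrix.diagonal_transpose]
        rw [h1, Matrix.transpose_sub, Matrix.transpose_sub, Matrix.transpose_add,
          Matrix.transpose_smul, hEt, h2, hQ, eq_sub_of_add_eq' hX, smul_neg, map_zero]
        abel
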